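/- Let $\Bbbk$ be a field, $H$ a bialgebra over $\Bbbk$, and $C$, $D$ left $H$-module coalgebras, i.e. coalgebras with a left $H$-action such that $\Delta(hc)=h_{(1)}c_{(1)}\otimes h_{(2)}c_{(2)}$ and $\varepsilon(hc)=\varepsilon(h)\varepsilon(c)$. Write $\mathfrak{M}^H$, $\mathfrak{M}^C$, $\mathfrak{M}^D$ for the categories of right comodules and ${}^C\mathfrak{M}^D$ for the category of $C$-$D$-bicomodules. The monoidal category $\mathfrak{M}^H$ acts from the left on $\mathfrak{M}^C$ (and likewise on $\mathfrak{M}^D$): for $X\in\mathfrak{M}^H$ and $W\in\mathfrak{M}^C$, the space $X\otimes W$ is a right $C$-comodule by $x\otimes w\mapsto x_{(0)}\otimes w_{(0)}\otimes x_{(1)}w_{(1)}$. Let ${}^C_H\mathfrak{M}^D$ be the category of $C$-$D$-bicomodules $M$ with a left $H$-action such that, writing $\rho^{\ell}$ and $\rho^{r}$ for the left and right coactions, $\rho^{\ell}(hm)=h_{(1)}m_{(-1)}\otimes h_{(2)}m_{(0)}$ and $\rho^{r}(hm)=h_{(1)}m_{(0)}\otimes h_{(2)}m_{(1)}$; its morphisms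 are the left $H$-linear, left $C$-colinear and right $D$-colinear maps. For $M\in{}^C\mathfrak{M}^D$ let $T_M=(-)\mathbin{\square}_C M:\mathfrak{M}^C\to\mathfrak{M}^D$, where $W\mathbin{\square}_C M=\mathrm{Ker}(\rho^{r}_W\otimes\mathrm{id}_M-\mathrm{id}_W\otimes\rho^{\ell}_M)\subseteq W\otimes M$. A lax left $\mathfrak{M}^H$-module functor $F:\mathfrak{M}^C\to\mathfrak{M}^D$ is a functor with a natural transformation $\xi_{X,W}:X\otimes F(W)\to F(X\otimes W)$, not necessarily invertible, satisfying, up to the canonical associativity and unit isomorphisms, $\xi_{X\otimes Y,W}=\xi_{X,Y\otimes W}\circ(\mathrm{id}_X\otimes\xi_{Y,W})$ and $\xi_{\mathbf 1,W}=\mathrm{id}$. (a) For each $M\in{}^C\mathfrak{M}^D$ the following two sets are in bijection: (1) the left $H$-actions $\bullet$ on $M$ making $M$ an object of ${}^C_H\mathfrak{M}^D$; (2) the natural transformations $\xi$ making $T_M$ a lax left $\mathfrak{M}^H$-module functor. The bijection sends $\bullet$ to the transformation $\xi^{\bullet}_{X,W}:X\otimes T_M(W)\to T_M(X\otimes W)$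 induced by $x\otimes(w\otimes m)\mapsto(x_{(0)}\otimes w)\otimes(x_{(1)}\bullet m)$, and its inverse sends $\xi$ to the action $h\bullet_{\xi}m=(\varepsilon_H\otimes\varepsilon_C\otimes\mathrm{id}_M)\,\xi_{H,C}(h\otimes m_{(-1)}\otimes m_{(0)})$. (b) Let $\mathscr{L}(\mathfrak{M}^C,\mathfrak{M}^D)$ be the category of left exact linear functors $\mathfrak{M}^C\to\mathfrak{M}^D$ preserving coproducts, and $\mathscr{L}^{\mathrm{lax}}_{\mathfrak{M}^H}(\mathfrak{M}^C,\mathfrak{M}^D)$ the category of lax left $\mathfrak{M}^H$-module functors whose underlying functor lies in $\mathscr{L}(\mathfrak{M}^C,\mathfrak{M}^D)$, with natural transformations compatible with the structure morphisms as morphisms. Takeuchi's functor ${}^C\mathfrak{M}^D\to\mathscr{L}(\mathfrak{M}^C,\mathfrak{M}^D)$, $M\mapsto T_M$, is an equivalence and it induces an equivalence $${}^C_H\mathfrak{M}^D\to\mathscr{L}^{\mathrm{lax}}_{\mathfrak{M}^H}(\mathfrak{M}^C,\mathfrak{M}^D),\qquad (M,\bullet)\mapsto(T_M,\xi^{\bullet}),$$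 that is, this assignment, which on underlying bicomodules and functors is Takeuchi's functor, is an equivalence of categories. -/

import Mathlib

open CategoryTheory CategoryTheory.Limits MonoidalCategory MonoidalLeftAction
open scoped TensorProduct

universe u

set_option linter.unusedSectionVars false

noncomputable section

namespace EquivEW

/-! ### Right comodules -/

/-- A right comodule over a `k`-coalgebra `C`. -/
structure RightComod (k : Type u) [Field k] (C : Type u) [AddCommGroup C] [Module k C]
    [Coalgebra k C] where
  /-- the underlying vector space -/
  carrier : Type u
  [isAddCommGroup : AddCommGroup carrier]
  [isModule : Module k carrier]
  /-- the coaction -/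
  ρ : carrier →ₗ[k] carrier ⊗[k] C
  coassoc : ∀ m, TensorProduct.assoc k carrier C C (ρ.rTensor C (ρ m)) =
    (Coalgebra.comul (R := k) (A := C)).lTensor carrier (ρ m)
  counit : ∀ m, TensorProduct.rid k carrier
    ((Coalgebra.counit (R := k) (A := C)).lTensor carrier (ρ m)) = m

namespace RightComod

variable {k : Type u} [Field k] {C : Type u} [AddCommGroup C] [Module k C] [Coalgebra k C]

instance : CoeSort (RightComod k C) (Type u) := ⟨RightComod.carrier⟩

instance (X : RightComod k C) : AddCommGroup X := X.isAddCommGroup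
instance (X : RightComod k C) : Module k X := X.isModule

/-- A morphism of right comodules is a colinear map. -/
@[ext]
structure Hom (X Y : RightComod k C) where
  /-- the underlying linear map -/
  toLin : X →ₗ[k] Y
  comm : ∀ m, Y.ρ (toLin m) = toLin.rTensor C (X.ρ m)

instance : Category (RightComod k C) where
  Hom X Y := Hom X Y
  id X := ⟨LinearMap.id, fun m => by simp⟩
  comp f g := ⟨g.toLin ∘ₗ f.toLin, fun m => by
    rw [LinearMap.comp_apply, g.comm, f.comm, LinearMap.rTensor_comp_apply]⟩

@[ext]
lemma hom_ext {X Y : RightComod k C} {f g : X ⟶ Y} (h : f.toLin = g.toLin) : f = g :=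
  Hom.ext h

@[simp] lemma id_toLin (X : RightComod k C) : Hom.toLin (𝟙 X) = LinearMap.id := rfl
@[simp] lemma comp_toLin {X Y Z : RightComod k C} (f : X ⟶ Y) (g : Y ⟶ Z) :
    (f ≫ g).toLin = g.toLin ∘ₗ f.toLin := rfl

section Linear

variable {X Y : RightComod k C}

instance : Zero (X ⟶ Y) := ⟨⟨0, fun m => by simp⟩⟩
instance : Add (X ⟶ Y) := ⟨fun f g => ⟨f.toLin + g.toLin, fun m => by
  simp [f.comm, g.comm, LinearMap.rTensor_add]⟩⟩
instance : Neg (X ⟶ Y) := ⟨fun f => ⟨-f.toLin, fun m => by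
  simp [f.comm, LinearMap.rTensor_neg]⟩⟩
instance : Sub (X ⟶ Y) := ⟨fun f g => ⟨f.toLin - g.toLin, fun m => by
  simp [f.comm, g.comm, LinearMap.rTensor_sub]⟩⟩
instance : SMul k (X ⟶ Y) := ⟨fun c f => ⟨c • f.toLin, fun m => by
  simp [f.comm, LinearMap.rTensor_smul]⟩⟩

@[simp] lemma zero_toLin : Hom.toLin (0 : X ⟶ Y) = 0 := rfl
@[simp] lemma add_toLin (f g : X ⟶ Y) : (f + g).toLin = f.toLin + g.toLin := rfl
@[simp] lemma neg_toLin (f : X ⟶ Y) : (-f).toLin = -f.toLin := rfl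
@[simp] lemma sub_toLin (f g : X ⟶ Y) : (f - g).toLin = f.toLin - g.toLin := rfl
@[simp] lemma smul_toLin (c : k) (f : X ⟶ Y) : (c • f).toLin = c • f.toLin := rfl

instance : AddCommGroup (X ⟶ Y) where
  add_assoc f g h := by ext1; simp [add_assoc]
  zero_add f := by ext1; simp
  add_zero f := by ext1; simp
  add_comm f g := by ext1; simp [add_comm]
  neg_add_cancel f := by ext1; simp
  sub_eq_add_neg f g := by ext1; simp [sub_eq_add_neg]
  nsmul := nsmulRec
  zsmul := zsmulRec

instance : Module k (X ⟶ Y) where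
  one_smul f := by ext1; simp
  mul_smul a b f := by ext1; simp [mul_smul]
  smul_zero a := by ext1; simp
  smul_add a f g := by ext1; simp
  add_smul a b f := by ext1; simp [add_smul]
  zero_smul f := by ext1; simp

end Linear

instance : Preadditive (RightComod k C) where
  add_comp _ _ _ f g h := by ext1; simp [LinearMap.comp_add]
  comp_add _ _ _ f g h := by ext1; simp [LinearMap.add_comp]

instance : Linear k (RightComod k C) where
  smul_comp _ _ _ a f g := by ext1; simp [LinearMap.comp_smul]
  comp_smul _ _ _ f a g := by ext1; simp [LinearMap.smul_comp]

/-- The coalgebra `C` as a right comodule over itself. -/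
abbrev regular (k : Type u) [Field k] (C : Type u) [AddCommGroup C] [Module k C]
    [Coalgebra k C] : RightComod k C where
  carrier := C
  ρ := Coalgebra.comul
  coassoc := Coalgebra.coassoc_apply
  counit m := by simp

/-- A colinear isomorphism gives an isomorphism of comodules. -/
def mkIso {X Y : RightComod k C} (e : X ≃ₗ[k] Y)
    (comm : ∀ m, Y.ρ (e m) = e.toLinearMap.rTensor C (X.ρ m)) : X ≅ Y where
  hom := ⟨e.toLinearMap, comm⟩
  inv := ⟨e.symm.toLinearMap, fun m => by
    have h := comm (e.symm m)
    rw [e.apply_symm_apply] at h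
    rw [h, ← LinearMap.rTensor_comp_apply]
    simp⟩
  hom_inv_id := by ext1; ext; simp
  inv_hom_id := by ext1; ext; simp

@[simp] lemma mkIso_hom_toLin {X Y : RightComod k C} (e : X ≃ₗ[k] Y)
    (comm : ∀ m, Y.ρ (e m) = e.toLinearMap.rTensor C (X.ρ m)) :
    (mkIso e comm).hom.toLin = e.toLinearMap := rfl

@[simp] lemma mkIso_inv_toLin {X Y : RightComod k C} (e : X ≃ₗ[k] Y)
    (comm : ∀ m, Y.ρ (e m) = e.toLinearMap.rTensor C (X.ρ m)) :
    (mkIso e comm).inv.toLin = e.symm.toLinearMap := rfl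

/-! ### Subcomodules -/

section Sub

variable (X : RightComod k C) (p : Submodule k X)

lemma rTensor_subtype_injective (V : Type u) [AddCommGroup V] [Module k V] :
    Function.Injective (p.subtype.rTensor V) :=
  Module.Flat.rTensor_preserves_injective_linearMap _ p.injective_subtype

/-- The coaction on a subspace `p` with `ρ(p) ⊆ p ⊗ C`. -/
def subρ (hp : ∀ t ∈ p, X.ρ t ∈ LinearMap.range (p.subtype.rTensor C)) : p →ₗ[k] p ⊗[k] C :=
  (LinearEquiv.ofInjective _ (X.rTensor_subtype_injective p C)).symm.toLinearMap ∘ₗ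
    (X.ρ ∘ₗ p.subtype).codRestrict _ (fun t => hp t t.2)

variable {X p}

lemma subρ_spec (hp : ∀ t ∈ p, X.ρ t ∈ LinearMap.range (p.subtype.rTensor C)) (t : p) :
    p.subtype.rTensor C (subρ X p hp t) = X.ρ t := by
  have h := LinearEquiv.apply_symm_apply
    (LinearEquiv.ofInjective _ (X.rTensor_subtype_injective p C))
    ((X.ρ ∘ₗ p.subtype).codRestrict _ (fun t => hp t t.2) t)
  exact congrArg Subtype.val h

/-- The subcomodule of `X` on a subspace `p` with `ρ(p) ⊆ p ⊗ C`. -/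
abbrev sub (X : RightComod k C) (p : Submodule k X)
    (hp : ∀ t ∈ p, X.ρ t ∈ LinearMap.range (p.subtype.rTensor C)) : RightComod k C where
  carrier := p
  ρ := subρ X p hp
  coassoc t := by
    apply X.rTensor_subtype_injective p
    have h1 : ∀ z : (p ⊗[k] C) ⊗[k] C,
        p.subtype.rTensor (C ⊗[k] C) (TensorProduct.assoc k p C C z) =
        TensorProduct.assoc k X C C ((p.subtype.rTensor C).rTensor C z) := by
      intro z
      induction z with
      | zero => simp
      | add a b ha hb => simp only [map_add, ha, hb]
      | tmul a c =>
        induction a with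
        | zero => simp
        | add a b ha hb => simp only [map_add, TensorProduct.add_tmul, ha, hb]
        | tmul a b => simp
    have h2 : p.subtype.rTensor C ∘ₗ subρ X p hp = X.ρ ∘ₗ p.subtype :=
      LinearMap.ext fun t => subρ_spec hp t
    rw [h1, ← LinearMap.rTensor_comp_apply, h2, LinearMap.rTensor_comp_apply, subρ_spec,
      X.coassoc, ← LinearMap.comp_apply, ← LinearMap.comp_apply, LinearMap.rTensor_comp_lTensor,
      ← LinearMap.lTensor_comp_rTensor, LinearMap.comp_apply, LinearMap.comp_apply]
    congr 1
    exact (subρ_spec hp t).symm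
  counit t := by
    apply p.injective_subtype
    have h1 : ∀ z : p ⊗[k] C, p.subtype (TensorProduct.rid k p
        ((Coalgebra.counit (R := k) (A := C)).lTensor p z)) = TensorProduct.rid k X
        ((Coalgebra.counit (R := k) (A := C)).lTensor X (p.subtype.rTensor C z)) := by
      intro z
      induction z with
      | zero => simp
      | add a b ha hb => simp only [map_add, ha, hb]
      | tmul a c => simp
    rw [h1, subρ_spec, X.counit]
    rfl

/-- The restriction of a linear map to a morphism between subcomodules. -/
def subHom {X Y : RightComod k C} {p : Submodule k X} {q : Submodule k Y}
    (hp : ∀ t ∈ p, X.ρ t ∈ LinearMap.range (p.subtype.rTensor C))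
    (hq : ∀ t ∈ q, Y.ρ t ∈ LinearMap.range (q.subtype.rTensor C))
    (f : X →ₗ[k] Y) (hf : ∀ t ∈ p, f t ∈ q)
    (comm : ∀ t ∈ p, Y.ρ (f t) = f.rTensor C (X.ρ t)) : sub X p hp ⟶ sub Y q hq where
  toLin := f.restrict hf
  comm := by
    have key : ∀ t : p, subρ Y q hq (f.restrict hf t) =
        (f.restrict hf).rTensor C (subρ X p hp t) := fun t => by
      apply Y.rTensor_subtype_injective q
      rw [subρ_spec, ← LinearMap.rTensor_comp_apply]
      have h : q.subtype ∘ₗ f.restrict hf = f ∘ₗ p.subtype := rfl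
      rw [h, LinearMap.rTensor_comp_apply, subρ_spec]
      exact comm t t.2
    exact key

end Sub

end RightComod

/-! ### Module coalgebras and the action of `H`-comodules -/

/-- A left `H`-module coalgebra: a coalgebra in the monoidal category of left `H`-modules.
The two equations are `Δ(hc) = h₁c₁ ⊗ h₂c₂` and `ε(hc) = ε(h)ε(c)`. -/
class IsModuleCoalgebra (k : Type u) [Field k] (H : Type u) [Ring H] [Bialgebra k H]
    (C : Type u) [AddCommGroup C] [Module k C] [Coalgebra k C]
    [Module H C] [IsScalarTower k H C] : Prop where
  comul_smul : ∀ (h : H) (c : C), Coalgebra.comul (R := k) (h • c) =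
    TensorProduct.map₂ (Algebra.lsmul k k C : H →ₐ[k] Module.End k C).toLinearMap
      (Algebra.lsmul k k C : H →ₐ[k] Module.End k C).toLinearMap
      (Coalgebra.comul (R := k) h) (Coalgebra.comul (R := k) c)
  counit_smul : ∀ (h : H) (c : C), Coalgebra.counit (R := k) (h • c) =
    Coalgebra.counit (R := k) h * Coalgebra.counit (R := k) c

section Tensor

variable {k : Type u} [Field k] {H : Type u} [Ring H] [Bialgebra k H]
variable {C : Type u} [AddCommGroup C] [Module k C] [Coalgebra k C]
  [Module H C] [IsScalarTower k H C]

variable (k H C) in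
/-- The action of `H` on a module coalgebra as a bilinear map. -/
abbrev smulMap : H →ₗ[k] C →ₗ[k] C :=
  (Algebra.lsmul k k C : H →ₐ[k] Module.End k C).toLinearMap

/-- A bialgebra is a module coalgebra over itself by the multiplication. -/
instance : IsModuleCoalgebra k H H where
  comul_smul h c := by
    rw [smul_eq_mul, Bialgebra.comul_mul]
    generalize Coalgebra.comul (R := k) h = a
    generalize Coalgebra.comul (R := k) c = b
    induction a with
    | zero => simp
    | add a a' ha ha' => simp only [add_mul, map_add, LinearMap.add_apply, ha, ha']
    | tmul x y =>
      induction b with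
      | zero => simp
      | add b b' hb hb' => simp only [mul_add, map_add, hb, hb']
      | tmul z w => simp
  counit_smul h c := by simp

/-- The coaction `x ⊗ w ↦ (x₀ ⊗ w₀) ⊗ x₁w₁` on the tensor product of a right `H`-comodule
and a right `C`-comodule. -/
def tensorρ (X : RightComod k H) (W : RightComod k C) :
    X ⊗[k] W →ₗ[k] (X ⊗[k] W) ⊗[k] C :=
  TensorProduct.lift (((TensorProduct.map₂ (TensorProduct.mk k X W) (smulMap k H C)).compl₂
    W.ρ) ∘ₗ X.ρ)

@[simp] lemma tensorρ_tmul (X : RightComod k H) (W : RightComod k C) (x : X) (w : W) :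
    tensorρ X W (x ⊗ₜ w) =
      TensorProduct.map₂ (TensorProduct.mk k X W) (smulMap k H C) (X.ρ x) (W.ρ w) := rfl


/-! Naturality and associativity of `TensorProduct.map₂`. -/

section map₂

variable {V₁ V₂ V₃ W₁ W₂ W₃ U₁ U₂ U₃ Z₁ Z₂ Z₃ P₁ P₂ Q₁ Q₂ : Type u}
  [AddCommGroup V₁] [Module k V₁] [AddCommGroup V₂] [Module k V₂] [AddCommGroup V₃] [Module k V₃]
  [AddCommGroup W₁] [Module k W₁] [AddCommGroup W₂] [Module k W₂] [AddCommGroup W₃] [Module k W₃]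
  [AddCommGroup U₁] [Module k U₁] [AddCommGroup U₂] [Module k U₂] [AddCommGroup U₃] [Module k U₃]
  [AddCommGroup Z₁] [Module k Z₁] [AddCommGroup Z₂] [Module k Z₂]
  [AddCommGroup P₁] [Module k P₁] [AddCommGroup P₂] [Module k P₂]

lemma rTensor_map₂ {φ : V₁ →ₗ[k] W₁ →ₗ[k] U₁} {φ' : V₂ →ₗ[k] W₂ →ₗ[k] U₂}
    {γ : Z₁ →ₗ[k] P₁ →ₗ[k] U₃} {f : U₁ →ₗ[k] U₂} {f₁ : V₁ →ₗ[k] V₂} {f₂ : W₁ →ₗ[k] W₂}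
    (h : ∀ x y, f (φ x y) = φ' (f₁ x) (f₂ y)) (a : V₁ ⊗[k] Z₁) (b : W₁ ⊗[k] P₁) :
    f.rTensor U₃ (TensorProduct.map₂ φ γ a b) =
      TensorProduct.map₂ φ' γ (f₁.rTensor Z₁ a) (f₂.rTensor P₁ b) := by
  induction a with
  | zero => simp
  | add a a' ha ha' => simp only [map_add, LinearMap.add_apply, ha, ha']
  | tmul x z =>
    induction b with
    | zero => simp
    | add b b' hb hb' => simp only [map_add, hb, hb']
    | tmul y p => simp [h]

lemma lTensor_map₂ {φ : V₁ →ₗ[k] W₁ →ₗ[k] U₁}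
    {γ : Z₁ →ₗ[k] P₁ →ₗ[k] U₂} {γ' : Z₂ →ₗ[k] P₂ →ₗ[k] U₃} {f : U₂ →ₗ[k] U₃}
    {f₁ : Z₁ →ₗ[k] Z₂} {f₂ : P₁ →ₗ[k] P₂}
    (h : ∀ x y, f (γ x y) = γ' (f₁ x) (f₂ y)) (a : V₁ ⊗[k] Z₁) (b : W₁ ⊗[k] P₁) :
    f.lTensor U₁ (TensorProduct.map₂ φ γ a b) =
      TensorProduct.map₂ φ γ' (f₁.lTensor V₁ a) (f₂.lTensor W₁ b) := by
  induction a with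
  | zero => simp
  | add a a' ha ha' => simp only [map_add, LinearMap.add_apply, ha, ha']
  | tmul x z =>
    induction b with
    | zero => simp
    | add b b' hb hb' => simp only [map_add, hb, hb']
    | tmul y p => simp [h]

lemma assoc_map₂ (φ : V₁ →ₗ[k] W₁ →ₗ[k] U₁) (γ : V₂ →ₗ[k] W₂ →ₗ[k] U₂)
    (δ : V₃ →ₗ[k] W₃ →ₗ[k] U₃) (a : (V₁ ⊗[k] V₂) ⊗[k] V₃) (b : (W₁ ⊗[k] W₂) ⊗[k] W₃) :
    TensorProduct.assoc k U₁ U₂ U₃ (TensorProduct.map₂ (TensorProduct.map₂ φ γ) δ a b) =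
      TensorProduct.map₂ φ (TensorProduct.map₂ γ δ) (TensorProduct.assoc k V₁ V₂ V₃ a)
        (TensorProduct.assoc k W₁ W₂ W₃ b) := by
  have : (TensorProduct.map₂ (TensorProduct.map₂ φ γ) δ).compr₂
      (TensorProduct.assoc k U₁ U₂ U₃).toLinearMap =
      (TensorProduct.map₂ φ (TensorProduct.map₂ γ δ)).compl₁₂
        (TensorProduct.assoc k V₁ V₂ V₃).toLinearMap
        (TensorProduct.assoc k W₁ W₂ W₃).toLinearMap := by
    ext x y z x' y' z'
    simp
  exact LinearMap.congr_fun₂ this a b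

/-- `(x ⊗ (w ⊗ v)) ↦ (x₀ ⊗ w) ⊗ (x₁ ⬝ v)` is compatible with the associator. -/
lemma rTensor_assoc_map₂ (act : H →ₐ[k] Module.End k U₁) (a : V₁ ⊗[k] H) (b : V₂ ⊗[k] H)
    (c : V₃ ⊗[k] U₁) :
    (TensorProduct.assoc k V₁ V₂ V₃).toLinearMap.rTensor U₁
      (TensorProduct.map₂ (TensorProduct.mk k (V₁ ⊗[k] V₂) V₃) act.toLinearMap
        (TensorProduct.map₂ (TensorProduct.mk k V₁ V₂) (smulMap k H H) a b) c) =
      TensorProduct.map₂ (TensorProduct.mk k V₁ (V₂ ⊗[k] V₃)) act.toLinearMap a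
        (TensorProduct.map₂ (TensorProduct.mk k V₂ V₃) act.toLinearMap b c) := by
  induction a with
  | zero => simp
  | add a a' ha ha' => simp only [map_add, LinearMap.add_apply, ha, ha']
  | tmul x z =>
    induction b with
    | zero => simp
    | add b b' hb hb' => simp only [map_add, LinearMap.add_apply, hb, hb']
    | tmul y p =>
      induction c with
      | zero => simp
      | add c c' hc hc' => simp only [map_add, hc, hc']
      | tmul w v => simp

end map₂

variable [IsModuleCoalgebra k H C]

/-- The tensor product of a right `H`-comodule and a right `C`-comodule as a right
`C`-comodule. -/
abbrev tensorObj (X : RightComod k H) (W : RightComod k C) : RightComod k C where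
  carrier := X ⊗[k] W
  ρ := tensorρ X W
  coassoc m := by
    induction m with
    | zero => simp
    | add a b ha hb => simp only [map_add, ha, hb]
    | tmul x w =>
      rw [tensorρ_tmul, rTensor_map₂ (f₁ := X.ρ) (f₂ := W.ρ) (fun x y => tensorρ_tmul X W x y),
        assoc_map₂, X.coassoc, W.coassoc, lTensor_map₂ (f₁ := Coalgebra.comul)
          (f₂ := Coalgebra.comul)]
      exact IsModuleCoalgebra.comul_smul
  counit m := by
    induction m with
    | zero => simp
    | add a b ha hb => simp only [map_add, ha, hb]
    | tmul x w =>
      rw [tensorρ_tmul, lTensor_map₂ (γ' := LinearMap.mul k k) (f₁ := Coalgebra.counit)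
        (f₂ := Coalgebra.counit) IsModuleCoalgebra.counit_smul]
      have h : ∀ (a : X ⊗[k] k) (b : W ⊗[k] k),
          TensorProduct.rid k (X ⊗[k] W) (TensorProduct.map₂ (TensorProduct.mk k X W)
            (LinearMap.mul k k) a b) = TensorProduct.rid k X a ⊗ₜ TensorProduct.rid k W b := by
        intro a b
        induction a with
        | zero => simp
        | add a a' ha ha' =>
          simp only [map_add, LinearMap.add_apply, ha, ha', TensorProduct.add_tmul]
        | tmul x z =>
          induction b with
          | zero => simp
          | add b b' hb hb' => simp only [map_add, hb, hb', TensorProduct.tmul_add]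
          | tmul y p => simp [mul_smul, TensorProduct.smul_tmul', smul_comm z p x]
      rw [h, X.counit, W.counit]

/-- The tensor product of two morphisms. -/
abbrev tensorMap {X X' : RightComod k H} {W W' : RightComod k C} (f : X ⟶ X') (g : W ⟶ W') :
    tensorObj X W ⟶ tensorObj X' W' where
  toLin := TensorProduct.map f.toLin g.toLin
  comm := fun (m : X ⊗[k] W) => by
    change tensorρ X' W' _ = LinearMap.rTensor C _ (tensorρ X W m)
    induction m with
    | zero => simp
    | add a b ha hb => simp only [map_add, ha, hb]
    | tmul x w =>
      rw [tensorρ_tmul, TensorProduct.map_tmul, tensorρ_tmul, f.comm, g.comm]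
      exact (rTensor_map₂ (fun x y => rfl) _ _).symm

/-- The trivial comodule `k` with coaction `1 ↦ 1 ⊗ 1`. -/
abbrev unitObj (k : Type u) [Field k] (H : Type u) [Ring H] [Bialgebra k H] :
    RightComod k H where
  carrier := k
  ρ := (TensorProduct.mk k k H).flip 1
  coassoc m := by simp [Algebra.TensorProduct.one_def]
  counit m := by simp

/-- The associativity isomorphism `(X ⊗ Y) ⊗ W ≅ X ⊗ (Y ⊗ W)`. -/
def assocIso (X Y : RightComod k H) (W : RightComod k C) :
    tensorObj (tensorObj X Y) W ≅ tensorObj X (tensorObj Y W) :=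
  RightComod.mkIso (TensorProduct.assoc k X Y W) fun (m : (X ⊗[k] Y) ⊗[k] W) => by
    change tensorρ X (tensorObj Y W) _ = LinearMap.rTensor C _ (tensorρ (tensorObj X Y) W m)
    induction m with
    | zero => simp
    | add a b ha hb => simp only [map_add, ha, hb]
    | tmul xy w =>
      induction xy with
      | zero => simp
      | add a b ha hb => simp only [map_add, TensorProduct.add_tmul, ha, hb]
      | tmul x y =>
        rw [TensorProduct.assoc_tmul]
        exact (rTensor_assoc_map₂ _ _ _ _).symm

/-- The isomorphism `k ⊗ W ≅ W`. -/
def leftUnitIso (W : RightComod k C) : tensorObj (unitObj k H) W ≅ W :=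
  RightComod.mkIso (TensorProduct.lid k W) fun (m : k ⊗[k] W) => by
    change _ = LinearMap.rTensor C _ (tensorρ (unitObj k H) W m)
    induction m with
    | zero => simp
    | add a b ha hb => simp only [map_add, ha, hb]
    | tmul r w =>
      have h : tensorρ (unitObj k H) W (r ⊗ₜ w) = TensorProduct.map₂ (TensorProduct.mk k k W)
        (smulMap k H C) (r ⊗ₜ 1) (W.ρ w) := rfl
      rw [h, TensorProduct.lid_tmul, map_smul]
      generalize W.ρ w = z
      induction z with
      | zero => simp
      | add a b ha hb => simp only [map_add, smul_add, ha, hb]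
      | tmul x c => simp [TensorProduct.smul_tmul']

/-- The isomorphism `X ⊗ k ≅ X`. -/
def rightUnitIso (X : RightComod k H) : tensorObj X (unitObj k H) ≅ X :=
  RightComod.mkIso (TensorProduct.rid k X) fun (m : X ⊗[k] k) => by
    change _ = LinearMap.rTensor H _ (tensorρ X (unitObj k H) m)
    induction m with
    | zero => simp
    | add a b ha hb => simp only [map_add, ha, hb]
    | tmul x r =>
      have h : tensorρ X (unitObj k H) (x ⊗ₜ r) = TensorProduct.map₂ (TensorProduct.mk k X k)
        (smulMap k H H) (X.ρ x) (r ⊗ₜ 1) := rfl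
      rw [h, TensorProduct.rid_tmul, map_smul]
      generalize X.ρ x = z
      induction z with
      | zero => simp
      | add a b ha hb => simp only [map_add, LinearMap.add_apply, smul_add, ha, hb]
      | tmul x c => simp [TensorProduct.smul_tmul']

instance : MonoidalCategory (RightComod k H) where
  tensorObj X Y := tensorObj X Y
  tensorHom f g := tensorMap f g
  whiskerLeft X _ _ f := tensorMap (𝟙 X) f
  whiskerRight f X := tensorMap f (𝟙 X)
  tensorUnit := unitObj k H
  associator X Y Z := assocIso X Y Z
  leftUnitor X := leftUnitIso X
  rightUnitor X := rightUnitIso X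
  tensorHom_def f g := by
    ext1; apply TensorProduct.ext'; intro x y; rfl
  id_tensorHom_id X Y := by
    ext1; apply TensorProduct.ext'; intro x y; rfl
  tensorHom_comp_tensorHom f g f' g' := by
    ext1; apply TensorProduct.ext'; intro x y; rfl
  whiskerLeft_id X Y := by
    ext1; apply TensorProduct.ext'; intro x y; rfl
  id_whiskerRight X Y := by
    ext1; apply TensorProduct.ext'; intro x y; rfl
  associator_naturality f g h := by
    ext1; apply TensorProduct.ext_threefold; intro x y z; rfl
  leftUnitor_naturality f := by
    ext1; apply TensorProduct.ext'; intro x y; exact (map_smul f.toLin _ _).symm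
  rightUnitor_naturality f := by
    ext1; apply TensorProduct.ext'; intro x y; exact (map_smul f.toLin _ _).symm
  pentagon W X Y Z := by
    ext1; apply TensorProduct.ext_fourfold; intro w x y z; rfl
  triangle X Y := by
    ext1; apply TensorProduct.ext_threefold; intro x r y
    exact (TensorProduct.smul_tmul r x y).symm

/-- The category of right `C`-comodules is a left module category over the monoidal category of
right `H`-comodules. -/
instance : MonoidalLeftAction (RightComod k H) (RightComod k C) where
  actionObj X W := tensorObj X W
  actionHomLeft f W := tensorMap f (𝟙 W)
  actionHomRight X _ _ f := tensorMap (𝟙 X) f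
  actionHom f g := tensorMap f g
  actionAssocIso X Y W := assocIso X Y W
  actionUnitIso W := leftUnitIso W
  actionHom_def f g := by
    ext1; apply TensorProduct.ext'; intro x y; rfl
  actionHomRight_id X Y := by
    ext1; apply TensorProduct.ext'; intro x y; rfl
  id_actionHomLeft X Y := by
    ext1; apply TensorProduct.ext'; intro x y; rfl
  actionHom_comp f g f' g' := by
    ext1; apply TensorProduct.ext'; intro x y; rfl
  actionAssocIso_hom_naturality f g h := by
    ext1; apply TensorProduct.ext_threefold; intro x y z; rfl
  actionUnitIso_hom_naturality f := by
    ext1; apply TensorProduct.ext'; intro x y; exact map_smul f.toLin _ _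
  whiskerLeft_actionHomLeft X Y Z f W := by
    ext1; apply TensorProduct.ext_threefold; intro x y z; rfl
  whiskerRight_actionHomLeft X f W := by
    ext1; apply TensorProduct.ext_threefold; intro x y z; rfl
  associator_actionHom W X Y Z := by
    ext1; apply TensorProduct.ext_fourfold; intro w x y z; rfl
  leftUnitor_actionHom X W := by
    ext1; apply TensorProduct.ext_threefold; intro x y z; rfl
  rightUnitor_actionHom X W := by
    ext1; apply TensorProduct.ext_threefold; intro x y z
    exact TensorProduct.smul_tmul _ _ _

end Tensor

/-! ### Bicomodules and the cotensor product -/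

/-- A `C`-`D`-bicomodule. -/
structure Bicomod (k : Type u) [Field k] (C : Type u) [AddCommGroup C] [Module k C]
    [Coalgebra k C] (D : Type u) [AddCommGroup D] [Module k D] [Coalgebra k D] where
  /-- the underlying vector space -/
  carrier : Type u
  [isAddCommGroup : AddCommGroup carrier]
  [isModule : Module k carrier]
  /-- the left coaction -/
  ρl : carrier →ₗ[k] C ⊗[k] carrier
  /-- the right coaction -/
  ρr : carrier →ₗ[k] carrier ⊗[k] D
  coassoc_left : ∀ m, TensorProduct.assoc k C C carrier
    ((Coalgebra.comul (R := k) (A := C)).rTensor carrier (ρl m)) = ρl.lTensor C (ρl m)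
  counit_left : ∀ m, TensorProduct.lid k carrier
    ((Coalgebra.counit (R := k) (A := C)).rTensor carrier (ρl m)) = m
  coassoc_right : ∀ m, TensorProduct.assoc k carrier D D (ρr.rTensor D (ρr m)) =
    (Coalgebra.comul (R := k) (A := D)).lTensor carrier (ρr m)
  counit_right : ∀ m, TensorProduct.rid k carrier
    ((Coalgebra.counit (R := k) (A := D)).lTensor carrier (ρr m)) = m
  compat : ∀ m, TensorProduct.assoc k C carrier D (ρl.rTensor D (ρr m)) = ρr.lTensor C (ρl m)

section Bicomod

variable {k : Type u} [Field k]
variable {C : Type u} [AddCommGroup C] [Module k C] [Coalgebra k C]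
variable {D : Type u} [AddCommGroup D] [Module k D] [Coalgebra k D]

namespace Bicomod

instance : CoeSort (Bicomod k C D) (Type u) := ⟨Bicomod.carrier⟩

instance (M : Bicomod k C D) : AddCommGroup M := M.isAddCommGroup
instance (M : Bicomod k C D) : Module k M := M.isModule

/-- A morphism of bicomodules is a left and right colinear map. -/
@[ext]
structure Hom (M N : Bicomod k C D) where
  /-- the underlying linear map -/
  toLin : M →ₗ[k] N
  comm_left : ∀ m, N.ρl (toLin m) = toLin.lTensor C (M.ρl m)
  comm_right : ∀ m, N.ρr (toLin m) = toLin.rTensor D (M.ρr m)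

instance : Category (Bicomod k C D) where
  Hom M N := Hom M N
  id M := ⟨LinearMap.id, fun m => by simp, fun m => by simp⟩
  comp f g := ⟨g.toLin ∘ₗ f.toLin,
    fun m => by
      rw [LinearMap.comp_apply, g.comm_left, f.comm_left, LinearMap.lTensor_comp_apply],
    fun m => by
      rw [LinearMap.comp_apply, g.comm_right, f.comm_right, LinearMap.rTensor_comp_apply]⟩

@[ext]
lemma hom_ext {M N : Bicomod k C D} {f g : M ⟶ N} (h : f.toLin = g.toLin) : f = g :=
  Hom.ext h

@[simp] lemma id_toLin (M : Bicomod k C D) : Hom.toLin (𝟙 M) = LinearMap.id := rfl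
@[simp] lemma comp_toLin {L M N : Bicomod k C D} (f : L ⟶ M) (g : M ⟶ N) :
    (f ≫ g).toLin = g.toLin ∘ₗ f.toLin := rfl

end Bicomod

/-- The right `D`-comodule `W ⊗ M` with coaction `id ⊗ ρ`. -/
abbrev freeTensor (W : RightComod k C) (M : Bicomod k C D) : RightComod k D where
  carrier := W ⊗[k] M
  ρ := (TensorProduct.assoc k W M D).symm.toLinearMap ∘ₗ M.ρr.lTensor W
  coassoc m := by
    induction m with
    | zero => simp
    | add a b ha hb => simp only [map_add, ha, hb]
    | tmul w m =>
      have h1 : ∀ z : M ⊗[k] D, TensorProduct.assoc k (W ⊗[k] M) D D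
          (((TensorProduct.assoc k W M D).symm.toLinearMap ∘ₗ M.ρr.lTensor W).rTensor D
            ((TensorProduct.assoc k W M D).symm (w ⊗ₜ z))) =
          (TensorProduct.assoc k W M (D ⊗[k] D)).symm
            (w ⊗ₜ TensorProduct.assoc k M D D (M.ρr.rTensor D z)) := by
        intro z
        induction z with
        | zero => simp
        | add a b ha hb => simp only [map_add, TensorProduct.tmul_add, ha, hb]
        | tmul m d =>
          simp only [TensorProduct.assoc_symm_tmul, LinearMap.rTensor_tmul, LinearMap.comp_apply,
            LinearMap.lTensor_tmul, LinearEquiv.coe_coe]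
          generalize M.ρr m = y
          induction y with
          | zero => simp
          | add a b ha hb =>
            simp only [map_add, TensorProduct.tmul_add, TensorProduct.add_tmul, ha, hb]
          | tmul m d => simp
      have h2 : ∀ z : M ⊗[k] D, (Coalgebra.comul (R := k) (A := D)).lTensor (W ⊗[k] M)
            ((TensorProduct.assoc k W M D).symm (w ⊗ₜ z)) =
          (TensorProduct.assoc k W M (D ⊗[k] D)).symm
            (w ⊗ₜ (Coalgebra.comul (R := k) (A := D)).lTensor M z) := by
        intro z
        induction z with
        | zero => simp
        | add a b ha hb => simp only [map_add, TensorProduct.tmul_add, ha, hb]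
        | tmul m d => simp
      exact (h1 _).trans ((congrArg (fun y => (TensorProduct.assoc k W M (D ⊗[k] D)).symm
        (w ⊗ₜ y)) (M.coassoc_right m)).trans (h2 _).symm)
  counit m := by
    induction m with
    | zero => simp
    | add a b ha hb => simp only [map_add, ha, hb]
    | tmul w m =>
      have h : ∀ z : M ⊗[k] D, TensorProduct.rid k (W ⊗[k] M)
          ((Coalgebra.counit (R := k) (A := D)).lTensor (W ⊗[k] M)
            ((TensorProduct.assoc k W M D).symm (w ⊗ₜ z))) =
          w ⊗ₜ TensorProduct.rid k M ((Coalgebra.counit (R := k) (A := D)).lTensor M z) := by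
        intro z
        induction z with
        | zero => simp
        | add a b ha hb => simp only [map_add, TensorProduct.tmul_add, ha, hb]
        | tmul m d => simp
      exact (h _).trans (congrArg (fun y => w ⊗ₜ[k] y) (M.counit_right m))

/-- The map `ρ ⊗ id - id ⊗ ρ : W ⊗ M → W ⊗ C ⊗ M`. -/
def cotensorMap (W : RightComod k C) (M : Bicomod k C D) : W ⊗[k] M →ₗ[k] W ⊗[k] (C ⊗[k] M) :=
  (TensorProduct.assoc k W C M).toLinearMap ∘ₗ W.ρ.rTensor M - M.ρl.lTensor W

/-- The cotensor product `W □_C M` as a subspace of `W ⊗ M`. -/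
def cotensor (W : RightComod k C) (M : Bicomod k C D) : Submodule k (W ⊗[k] M) :=
  LinearMap.ker (cotensorMap W M)

lemma mem_cotensor {W : RightComod k C} {M : Bicomod k C D} {t : W ⊗[k] M} :
    t ∈ cotensor W M ↔
      TensorProduct.assoc k W C M (W.ρ.rTensor M t) = M.ρl.lTensor W t := by
  simp [cotensor, cotensorMap, sub_eq_zero]

lemma cotensor_coaction (W : RightComod k C) (M : Bicomod k C D) :
    ∀ t ∈ cotensor W M,
      (freeTensor W M).ρ t ∈ LinearMap.range ((cotensor W M).subtype.rTensor D) := by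
  intro t ht
  have hex := Module.Flat.rTensor_exact D
    (f := (cotensor W M).subtype) (g := cotensorMap W M)
    (LinearMap.exact_subtype_ker_map _)
  refine (hex _).1 ?_
  have key : (cotensorMap W M).rTensor D ∘ₗ (freeTensor W M).ρ =
      ((TensorProduct.assoc k W (C ⊗[k] M) D).symm.toLinearMap ∘ₗ
        ((TensorProduct.assoc k C M D).symm.toLinearMap ∘ₗ M.ρr.lTensor C).lTensor W) ∘ₗ
        cotensorMap W M := by
    apply TensorProduct.ext'
    intro w m
    have h1 : ∀ (z : M ⊗[k] D),
        ((TensorProduct.assoc k W C M).toLinearMap ∘ₗ W.ρ.rTensor M).rTensor D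
          ((TensorProduct.assoc k W M D).symm (w ⊗ₜ z)) =
        (TensorProduct.assoc k W (C ⊗[k] M) D).symm
          ((TensorProduct.assoc k C M D).symm.toLinearMap.lTensor W
            (TensorProduct.assoc k W C (M ⊗[k] D) (W.ρ w ⊗ₜ z))) := by
      intro z
      induction z with
      | zero => simp
      | add a b ha hb => simp only [map_add, TensorProduct.tmul_add, ha, hb]
      | tmul m d =>
        simp only [TensorProduct.assoc_symm_tmul, LinearMap.rTensor_tmul, LinearMap.comp_apply,
            LinearEquiv.coe_coe]
        generalize W.ρ w = y
        induction y with
        | zero => simp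
        | add a b ha hb =>
          simp only [map_add, TensorProduct.add_tmul, ha, hb]
        | tmul m d => simp
    have h2 : ∀ y : W ⊗[k] C, TensorProduct.assoc k W C (M ⊗[k] D) (y ⊗ₜ M.ρr m) =
        (M.ρr.lTensor C).lTensor W (TensorProduct.assoc k W C M (y ⊗ₜ m)) := by
      intro y
      induction y with
      | zero => simp
      | add a b ha hb =>
        simp only [map_add, TensorProduct.add_tmul, ha, hb]
      | tmul w c => simp
    have h3 : ∀ (z : M ⊗[k] D), (M.ρl.lTensor W).rTensor D
          ((TensorProduct.assoc k W M D).symm (w ⊗ₜ z)) =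
        (TensorProduct.assoc k W (C ⊗[k] M) D).symm (w ⊗ₜ M.ρl.rTensor D z) := by
      intro z
      induction z with
      | zero => simp
      | add a b ha hb => simp only [map_add, TensorProduct.tmul_add, ha, hb]
      | tmul m d => simp
    have h4 : M.ρl.rTensor D (M.ρr m) =
        (TensorProduct.assoc k C M D).symm (M.ρr.lTensor C (M.ρl m)) := by
      rw [← M.compat, LinearEquiv.symm_apply_apply]
    simp only [cotensorMap, LinearMap.rTensor_sub, LinearMap.comp_apply, LinearMap.sub_apply,
      LinearMap.lTensor_tmul, LinearEquiv.coe_coe, map_sub, LinearMap.lTensor_comp,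
      LinearMap.rTensor_tmul]
    rw [h1, h2, h3, h4]
  have h := LinearMap.congr_fun key t
  refine h.trans ?_
  rw [LinearMap.comp_apply, LinearMap.mem_ker.1 ht, map_zero]

/-- The cotensor product `W □_C M` as a right `D`-comodule, with coaction induced by that
of `M`. -/
abbrev cotensorObj (W : RightComod k C) (M : Bicomod k C D) : RightComod k D :=
  RightComod.sub (freeTensor W M) (cotensor W M) (cotensor_coaction W M)

/-- The morphism `f □ g : W □_C M → W' □_C M'`. -/
def cotensorHom {W W' : RightComod k C} {M M' : Bicomod k C D} (f : W ⟶ W') (g : M ⟶ M') :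
    cotensorObj W M ⟶ cotensorObj W' M' :=
  RightComod.subHom _ _ (TensorProduct.map f.toLin g.toLin)
    (fun t ht => by
      rw [mem_cotensor] at ht ⊢
      have h1 : W'.ρ.rTensor M' ∘ₗ TensorProduct.map f.toLin g.toLin =
          TensorProduct.map (f.toLin.rTensor C) g.toLin ∘ₗ W.ρ.rTensor M :=
        TensorProduct.ext' fun w m => by simp [f.comm]
      have h2 : M'.ρl.lTensor W' ∘ₗ TensorProduct.map f.toLin g.toLin =
          TensorProduct.map f.toLin (g.toLin.lTensor C) ∘ₗ M.ρl.lTensor W :=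
        TensorProduct.ext' fun w m => by simp [g.comm_left]
      have h3 : (TensorProduct.assoc k W' C M').toLinearMap ∘ₗ
          TensorProduct.map (f.toLin.rTensor C) g.toLin =
          TensorProduct.map f.toLin (g.toLin.lTensor C) ∘ₗ
            (TensorProduct.assoc k W C M).toLinearMap :=
        TensorProduct.ext_threefold fun w c m => by simp
      have h1' := LinearMap.congr_fun h1 t
      have h2' := LinearMap.congr_fun h2 t
      have h3' := LinearMap.congr_fun h3 (W.ρ.rTensor M t)
      simp only [LinearMap.comp_apply, LinearEquiv.coe_coe] at h1' h2' h3'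
      rw [h1', h2', h3', ht])
    (fun (t : W ⊗[k] M) _ => by
      change (freeTensor W' M').ρ _ = LinearMap.rTensor D _ ((freeTensor W M).ρ t)
      clear * -
      induction t using TensorProduct.induction_on with
      | zero => simp
      | add a b ha hb => simp only [map_add, ha, hb]
      | tmul w m =>
        simp only [TensorProduct.map_tmul, LinearMap.comp_apply, LinearMap.lTensor_tmul,
          LinearEquiv.coe_coe, g.comm_right]
        generalize M.ρr m = z
        induction z with
        | zero => simp
        | add a b ha hb => simp only [map_add, TensorProduct.tmul_add, ha, hb]
        | tmul m d => simp)

@[simp] lemma cotensorHom_coe {W W' : RightComod k C} {M M' : Bicomod k C D} (f : W ⟶ W')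
    (g : M ⟶ M') (t : cotensor W M) :
    ((cotensorHom f g).toLin t : cotensor W' M').1 = TensorProduct.map f.toLin g.toLin t.1 := rfl

lemma cotensor_hom_ext {X : RightComod k D} {W : RightComod k C} {M : Bicomod k C D}
    {f g : X ⟶ cotensorObj W M}
    (h : ∀ x, (f.toLin x : cotensor W M).1 = (g.toLin x : cotensor W M).1) : f = g :=
  RightComod.hom_ext (LinearMap.ext fun x => Subtype.ext (h x))

@[simp] lemma cotensorHom_id (W : RightComod k C) (M : Bicomod k C D) :
    cotensorHom (𝟙 W) (𝟙 M) = 𝟙 (cotensorObj W M) :=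
  cotensor_hom_ext fun (t : cotensor W M) =>
    LinearMap.congr_fun (TensorProduct.map_id (R := k) (M := W) (N := M)) t.1

lemma cotensorHom_comp {W W' W'' : RightComod k C} {M M' M'' : Bicomod k C D} (f : W ⟶ W')
    (f' : W' ⟶ W'') (g : M ⟶ M') (g' : M' ⟶ M'') :
    cotensorHom f g ≫ cotensorHom f' g' = cotensorHom (f ≫ f') (g ≫ g') :=
  cotensor_hom_ext fun (t : cotensor W M) =>
    (LinearMap.congr_fun (TensorProduct.map_comp f'.toLin g'.toLin f.toLin g.toLin) t.1).symm

/-- The cotensor functor `T_M = (-) □_C M`. -/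
abbrev cotensorFunctor (M : Bicomod k C D) : RightComod k C ⥤ RightComod k D where
  obj W := cotensorObj W M
  map f := cotensorHom f (𝟙 M)
  map_id W := cotensorHom_id W M
  map_comp f g := by rw [cotensorHom_comp, Category.comp_id]

variable (k C D) in
/-- The functor `M ↦ (-) □_C M` from bicomodules to functors. -/
def takeuchiFunctor : Bicomod k C D ⥤ (RightComod k C ⥤ RightComod k D) where
  obj M := cotensorFunctor M
  map {M N} g :=
    { app W := cotensorHom (𝟙 W) g
      naturality W W' f := by
        change cotensorHom _ _ ≫ cotensorHom _ _ = cotensorHom _ _ ≫ cotensorHom _ _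
        rw [cotensorHom_comp, cotensorHom_comp]
        simp }
  map_id M := NatTrans.ext (funext fun W => cotensorHom_id W M)
  map_comp {L M N} f g := NatTrans.ext (funext fun W => by
    change cotensorHom (𝟙 W) (f ≫ g) = cotensorHom _ _ ≫ cotensorHom _ _
    rw [cotensorHom_comp, Category.comp_id])

/-- A functor between categories of comodules is of type `𝓛` if it is linear, left exact, and
preserves (small) coproducts. -/
structure IsTypeL (F : RightComod k C ⥤ RightComod k D) : Prop where
  additive : F.Additive
  linear : F.Linear k
  leftExact : PreservesFiniteLimits F
  coproducts : ∀ J : Type u, PreservesColimitsOfShape (Discrete J) F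

end Bicomod

/-! ### Lax module functors -/

/-- A lax left `V`-module functor between left `V`-module categories. -/
structure LaxModuleFunctor (V : Type*) [Category* V] [MonoidalCategory V]
    (A B : Type*) [Category* A] [Category* B] [MonoidalLeftAction V A] [MonoidalLeftAction V B] where
  /-- the underlying functor -/
  functor : A ⥤ B
  /-- the structure morphism `X ⊗ F(M) ⟶ F(X ⊗ M)` -/
  lax : functor.LaxLeftLinear V

namespace LaxModuleFunctor

variable {V : Type*} [Category* V] [MonoidalCategory V]
    {A B : Type*} [Category* A] [Category* B] [MonoidalLeftAction V A] [MonoidalLeftAction V B]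

/-- A morphism of lax module functors is a natural transformation compatible with the structure
morphisms. -/
@[ext]
structure Hom (F G : LaxModuleFunctor V A B) where
  /-- the underlying natural transformation -/
  nat : F.functor ⟶ G.functor
  comm : ∀ (X : V) (W : A), F.lax.μₗ X W ≫ nat.app (X ⊙ₗ W) = X ⊴ₗ nat.app W ≫ G.lax.μₗ X W

instance : Category (LaxModuleFunctor V A B) where
  Hom F G := Hom F G
  id F := ⟨𝟙 F.functor, fun X W => by simp⟩
  comp f g := ⟨f.nat ≫ g.nat, fun X W => by
    rw [NatTrans.comp_app, NatTrans.comp_app, ← Category.assoc, f.comm, Category.assoc, g.comm,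
      actionHomRight_comp, Category.assoc]⟩

variable (V A B) in
/-- The functor forgetting the lax module structure. -/
def forget : LaxModuleFunctor V A B ⥤ (A ⥤ B) where
  obj F := F.functor
  map f := f.nat

end LaxModuleFunctor

/-! ### Equivariant bicomodules -/

section Equivariant

variable {k : Type u} [Field k] {H : Type u} [Ring H] [Bialgebra k H]
variable {C : Type u} [AddCommGroup C] [Module k C] [Coalgebra k C]
  [Module H C] [IsScalarTower k H C]
variable {D : Type u} [AddCommGroup D] [Module k D] [Coalgebra k D]
  [Module H D] [IsScalarTower k H D]

variable (H) in
/-- A left `H`-action on a bicomodule `M` making it a `C`-`D`-bicomodule in the monoidal category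
of left `H`-modules: the coactions satisfy `ρˡ(hm) = h₁m₋₁ ⊗ h₂m₀` and `ρʳ(hm) = h₁m₀ ⊗ h₂m₁`. -/
@[ext]
structure EquivariantAction (M : Bicomod k C D) where
  /-- the action -/
  act : H →ₐ[k] Module.End k M
  coact_left : ∀ (h : H) (m : M), M.ρl (act h m) =
    TensorProduct.map₂ (smulMap k H C) act.toLinearMap (Coalgebra.comul (R := k) h) (M.ρl m)
  coact_right : ∀ (h : H) (m : M), M.ρr (act h m) =
    TensorProduct.map₂ act.toLinearMap (smulMap k H D) (Coalgebra.comul (R := k) h) (M.ρr m)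

variable (k H C D) in
/-- A `C`-`D`-bicomodule in the monoidal category of left `H`-modules. -/
structure EquivBicomod where
  /-- the underlying bicomodule -/
  toBicomod : Bicomod k C D
  /-- the left `H`-action -/
  action : EquivariantAction H toBicomod

namespace EquivBicomod

/-- A morphism is a left `H`-linear, left `C`-colinear and right `D`-colinear map. -/
@[ext]
structure Hom (M N : EquivBicomod k H C D) where
  /-- the underlying morphism of bicomodules -/
  hom : M.toBicomod ⟶ N.toBicomod
  map_act : ∀ (h : H) (m : M.toBicomod),
    hom.toLin (M.action.act h m) = N.action.act h (hom.toLin m)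

instance : Category (EquivBicomod k H C D) where
  Hom M N := Hom M N
  id M := ⟨𝟙 M.toBicomod, fun h m => rfl⟩
  comp f g := ⟨f.hom ≫ g.hom, fun h m => by
    simp only [Bicomod.comp_toLin, LinearMap.comp_apply, f.map_act, g.map_act]⟩

variable (k H C D) in
/-- The functor forgetting the `H`-action. -/
def forget : EquivBicomod k H C D ⥤ Bicomod k C D where
  obj M := M.toBicomod
  map f := f.hom

end EquivBicomod

variable {M : Bicomod k C D}

/-- The linear map `x ⊗ (w ⊗ m) ↦ (x₀ ⊗ w) ⊗ x₁m`. -/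
def actionMap (act : H →ₐ[k] Module.End k M) (X : RightComod k H) (W : RightComod k C) :
    X ⊗[k] (W ⊗[k] M) →ₗ[k] (X ⊗[k] W) ⊗[k] M :=
  TensorProduct.lift ((TensorProduct.map₂ (TensorProduct.mk k X W) act.toLinearMap) ∘ₗ X.ρ)

@[simp] lemma actionMap_tmul (act : H →ₐ[k] Module.End k M) (X : RightComod k H)
    (W : RightComod k C) (x : X) (t : W ⊗[k] M) :
    actionMap act X W (x ⊗ₜ t) =
      TensorProduct.map₂ (TensorProduct.mk k X W) act.toLinearMap (X.ρ x) t := rfl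

variable [IsModuleCoalgebra k H C] [IsModuleCoalgebra k H D]

lemma actionMap_mem (a : EquivariantAction H M) (X : RightComod k H) (W : RightComod k C)
    (t : X ⊗[k] cotensor W M) :
    actionMap a.act X W ((cotensor W M).subtype.lTensor X t) ∈ cotensor (tensorObj X W) M := by
  induction t with
  | zero => simp
  | add s t hs ht => rw [map_add, map_add]; exact add_mem hs ht
  | tmul x t =>
    rw [LinearMap.lTensor_tmul, actionMap_tmul, mem_cotensor]
    have ht := mem_cotensor.1 t.2
    rw [rTensor_map₂ (f₁ := X.ρ) (f₂ := W.ρ) (fun x y => tensorρ_tmul X W x y)]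
    refine (assoc_map₂ _ _ _ _ _).trans ?_
    rw [X.coassoc, Submodule.subtype_apply, ht]
    exact (lTensor_map₂ (fun h m => a.coact_left h m) _ _).symm

/-- The structure morphism `X ⊗ (W □ M) ⟶ (X ⊗ W) □ M` induced by
`x ⊗ (w ⊗ m) ↦ (x₀ ⊗ w) ⊗ x₁m`. -/
def laxHom (a : EquivariantAction H M) (X : RightComod k H) (W : RightComod k C) :
    tensorObj X (cotensorObj W M) ⟶ cotensorObj (tensorObj X W) M where
  toLin := (actionMap a.act X W ∘ₗ (cotensor W M).subtype.lTensor X).codRestrict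
    (cotensor (tensorObj X W) M) (actionMap_mem a X W)
  comm := by
    have key : ∀ (x : X) (s : W ⊗[k] M),
        (freeTensor (tensorObj X W) M).ρ (actionMap a.act X W (x ⊗ₜ s)) =
          (actionMap a.act X W).rTensor D (TensorProduct.map₂ (TensorProduct.mk k X (W ⊗[k] M))
            (smulMap k H D) (X.ρ x) ((freeTensor W M).ρ s)) := by
      intro x s
      rw [rTensor_map₂ (f₁ := X.ρ) (f₂ := LinearMap.id)
        (fun x y => actionMap_tmul a.act X W x y)]
      apply (TensorProduct.assoc k (X ⊗[k] W) M D).injective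
      rw [assoc_map₂, X.coassoc, LinearMap.rTensor_id, LinearMap.id_apply]
      have h1 : ∀ z, TensorProduct.assoc k W M D ((freeTensor W M).ρ z) = M.ρr.lTensor W z :=
        fun z => LinearEquiv.apply_symm_apply _ _
      have h2 : ∀ z, TensorProduct.assoc k (X ⊗[k] W) M D
          ((freeTensor (tensorObj X W) M).ρ z) = M.ρr.lTensor (X ⊗[k] W) z :=
        fun z => LinearEquiv.apply_symm_apply _ _
      rw [h1, h2, actionMap_tmul]
      exact lTensor_map₂ (fun h m => a.coact_right h m) _ _
    have main : ∀ t : X ⊗[k] cotensor W M,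
        RightComod.subρ (freeTensor (tensorObj X W) M) (cotensor (tensorObj X W) M)
          (cotensor_coaction _ _)
          ((actionMap a.act X W ∘ₗ (cotensor W M).subtype.lTensor X).codRestrict
            (cotensor (tensorObj X W) M) (actionMap_mem a X W) t) =
        ((actionMap a.act X W ∘ₗ (cotensor W M).subtype.lTensor X).codRestrict
            (cotensor (tensorObj X W) M) (actionMap_mem a X W)).rTensor D
          (tensorρ X (cotensorObj W M) t) := by
      intro t
      induction t with
      | zero => simp
      | add s t hs ht => simp only [map_add, hs, ht]
      | tmul x t =>
        apply RightComod.rTensor_subtype_injective (freeTensor (tensorObj X W) M)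
          (cotensor (tensorObj X W) M)
        refine (RightComod.subρ_spec (cotensor_coaction (tensorObj X W) M) _).trans ?_
        rw [← LinearMap.rTensor_comp_apply, LinearMap.subtype_comp_codRestrict,
          LinearMap.rTensor_comp_apply]
        refine (key x t.1).trans (congrArg _ ?_)
        refine (congrArg _
          (RightComod.subρ_spec (X := freeTensor W M) (cotensor_coaction W M) t).symm).trans ?_
        have h := rTensor_map₂ (φ := TensorProduct.mk k X (cotensor W M))
          (φ' := TensorProduct.mk k X (W ⊗[k] M)) (γ := smulMap k H D)
          (f := (cotensor W M).subtype.lTensor X) (f₁ := LinearMap.id)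
          (f₂ := (cotensor W M).subtype) (fun x y => rfl) (X.ρ x)
          (RightComod.subρ (freeTensor W M) (cotensor W M) (cotensor_coaction W M) t)
        rw [LinearMap.rTensor_id, LinearMap.id_apply] at h
        exact h.symm
    exact main

lemma laxHom_coe (a : EquivariantAction H M) (X : RightComod k H) (W : RightComod k C)
    (t : X ⊗[k] cotensor W M) :
    ((laxHom a X W).toLin t : cotensor (tensorObj X W) M).1 =
      actionMap a.act X W ((cotensor W M).subtype.lTensor X t) := rfl

lemma tensor_cotensor_hom_ext {X : RightComod k H} {W : RightComod k C} {W' : RightComod k C}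
    {N : Bicomod k C D} {f g : tensorObj X (cotensorObj W M) ⟶ cotensorObj W' N}
    (h : ∀ (x : X) (t : cotensor W M),
      (f.toLin (x ⊗ₜ[k] t) : cotensor W' N).1 = (g.toLin (x ⊗ₜ[k] t) : cotensor W' N).1) :
    f = g :=
  RightComod.hom_ext (TensorProduct.ext' fun x t => Subtype.ext (h x t))

lemma tensor_tensor_cotensor_hom_ext {X Y : RightComod k H} {W : RightComod k C}
    {W' : RightComod k C} {f g : tensorObj (tensorObj X Y) (cotensorObj W M) ⟶ cotensorObj W' M}
    (h : ∀ (x : X) (y : Y) (t : cotensor W M),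
      (f.toLin ((x ⊗ₜ[k] y) ⊗ₜ[k] t) : cotensor W' M).1 =
        (g.toLin ((x ⊗ₜ[k] y) ⊗ₜ[k] t) : cotensor W' M).1) :
    f = g :=
  RightComod.hom_ext (TensorProduct.ext_threefold fun x y t => Subtype.ext (h x y t))

lemma actionMap_natural (act : H →ₐ[k] Module.End k M) {X X' : RightComod k H}
    {W W' : RightComod k C} (f : X ⟶ X') (g : W ⟶ W') (x : X) (t : W ⊗[k] M) :
    actionMap act X' W' (f.toLin x ⊗ₜ TensorProduct.map g.toLin LinearMap.id t) =
      TensorProduct.map (TensorProduct.map f.toLin g.toLin) LinearMap.id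
        (actionMap act X W (x ⊗ₜ t)) := by
  rw [actionMap_tmul, actionMap_tmul, f.comm]
  exact (rTensor_map₂ (fun x y => rfl) _ _).symm

/-- The lax module structure on the cotensor functor determined by an `H`-action. -/
abbrev laxOfAction (a : EquivariantAction H M) :
    (cotensorFunctor M).LaxLeftLinear (RightComod k H) where
  μₗ X W := laxHom a X W
  μₗ_naturality_left {X X'} f W := by
    refine tensor_cotensor_hom_ext fun x t => ?_
    refine Eq.trans ?_ (actionMap_natural a.act f (𝟙 W) x t.1)
    exact congrArg (fun s => actionMap a.act X' W (f.toLin x ⊗ₜ s))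
      (LinearMap.congr_fun (TensorProduct.map_id (R := k) (M := W) (N := M)) t.1).symm
  μₗ_naturality_right X {W W'} f := by
    refine tensor_cotensor_hom_ext fun x t => ?_
    exact actionMap_natural a.act (𝟙 X) f x t.1
  μₗ_associativity X Y W := by
    refine tensor_tensor_cotensor_hom_ext fun x y t => ?_
    exact rTensor_assoc_map₂ a.act (X.ρ x) (Y.ρ y) t.1
  μₗ_unitality W := by
    refine tensor_cotensor_hom_ext fun (r : k) t => ?_
    change r • t.1 = (TensorProduct.lid k W).toLinearMap.rTensor M
      (TensorProduct.map₂ (TensorProduct.mk k k W) a.act.toLinearMap (r ⊗ₜ 1) t.1)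
    generalize t.1 = s
    induction s with
    | zero => simp
    | add s t hs ht => simp only [map_add, smul_add, hs, ht]
    | tmul w m => simp [TensorProduct.smul_tmul']

/-- The operation `h • m = (ε ⊗ ε ⊗ id) ξ_{H,C}(h ⊗ m₋₁ ⊗ m₀)` determined by a lax module
structure `ξ` on the cotensor functor. -/
def operationOfLax (ξ : (cotensorFunctor M).LaxLeftLinear (RightComod k H)) (h : H) (m : M) : M :=
  TensorProduct.lid k M
    ((LinearMap.mul' k k ∘ₗ TensorProduct.map (Coalgebra.counit (R := k) (A := H))
      (Coalgebra.counit (R := k) (A := C))).rTensor M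
      (((ξ.μₗ (RightComod.regular k H) (RightComod.regular k C)).toLin
        (h ⊗ₜ[k] (⟨M.ρl m, mem_cotensor.2 (M.coassoc_left m)⟩ :
          cotensor (RightComod.regular k C) M)) :
        cotensor (tensorObj (RightComod.regular k H) (RightComod.regular k C)) M) :
          (H ⊗[k] C) ⊗[k] M))

lemma actionMap_linear {M N : EquivBicomod k H C D} (f : M ⟶ N) (X : RightComod k H)
    (W : RightComod k C) (x : X) (t : W ⊗[k] M.toBicomod) :
    TensorProduct.map LinearMap.id f.hom.toLin (actionMap M.action.act X W (x ⊗ₜ t)) =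
      actionMap N.action.act X W (x ⊗ₜ TensorProduct.map LinearMap.id f.hom.toLin t) := by
  rw [actionMap_tmul, actionMap_tmul]
  refine (lTensor_map₂ (f₁ := LinearMap.id) (f₂ := f.hom.toLin)
    (γ' := N.action.act.toLinearMap) (fun h m => f.map_act h m) _ _).trans ?_
  rw [LinearMap.lTensor_id]
  rfl

variable (k H C D) in
/-- The functor sending an object `M` of the category of `C`-`D`-bicomodules in left `H`-modules
to `(-) □_C M` with its lax module structure. -/
def equivariantTakeuchiFunctor :
    EquivBicomod k H C D ⥤ LaxModuleFunctor (RightComod k H) (RightComod k C) (RightComod k D) where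
  obj M := ⟨cotensorFunctor M.toBicomod, laxOfAction M.action⟩
  map {M N} f := ⟨(takeuchiFunctor k C D).map f.hom, fun X W => by
    refine tensor_cotensor_hom_ext fun x t => ?_
    exact actionMap_linear f X W x t.1⟩
  map_id M := LaxModuleFunctor.Hom.ext ((takeuchiFunctor k C D).map_id M.toBicomod)
  map_comp f g := LaxModuleFunctor.Hom.ext ((takeuchiFunctor k C D).map_comp f.hom g.hom)

end Equivariant

end EquivEW

end

open EquivEW

noncomputable section

namespace EquivEW

namespace RightComod

section Comodules

variable {k : Type u} [Field k] {C : Type u} [AddCommGroup C] [Module k C] [Coalgebra k C]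

/-! The coaction embeds every comodule `W` colinearly in the cofree comodule `W ⊗ C`, and the maps
`c ↦ w ⊗ c` from `C` to `W ⊗ C` are colinear as well. A family of linear maps natural in `W` is
therefore determined by its member at `W = C`, and the counit extracts that information. This gives
`natural_coaction_formula` (families `X → X ⊗ V`) and `natural_cotensor_formula` (families `W □ M →
W ⊗ V`, which are all `id ⊗ g` for a single `g : M → V`).

Full faithfulness of Takeuchi's functor is the second formula applied to a natural transformation
`T_M → T_N`: left colinearity of `g` is the equation defining `C □ N`, and right colinearity holds
because `g` is a composite of colinear maps.

For part (a), a lax structure `ξ` is natural in both variables. Applying one formula in each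
variable shows that `ξ` is `x ⊗ (w ⊗ m) ↦ (x₀ ⊗ w) ⊗ x₁m` for one bilinear operation `H × M → M`
(`laxLin_tmul`). Unitality and associativity of `ξ` at `H` and `C` become the axioms of an action.
That `ξ` takes values in the cotensor product gives compatibility with the left coaction, and that
it is `D`-colinear gives compatibility with the right one.

For essential surjectivity, let `F` be linear, left exact and coproduct-preserving. A basis of `U`
makes `U ⊗ X` a direct sum of copies of `X`, so the canonical map `theta : U ⊗ F(X) → F(U ⊗ X)` is
invertible (`isIso_theta`). The comodule `W` is the kernel of `ρ ⊗ id - id ⊗ Δ : W ⊗ C → (W ⊗ C) ⊗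
C` (`isLimitCoactionHom`). Applying `F` and transporting along `theta` identifies `F(W)` with the
kernel that defines `W □ F(C)` (`mem_range_phi`). In the equivariant case the lax structure of `F`
is transported to the cotensor functor, where part (a) turns it into an action. -/

lemma congr_toLin {X Y : RightComod k C} {f g : X ⟶ Y} (h : f = g) (x : X) :
    f.toLin x = g.toLin x := by rw [h]

/-- A bijective colinear map is an isomorphism. -/
def isoOfBijective {X Y : RightComod k C} (f : X ⟶ Y) (hf : Function.Bijective f.toLin) : X ≅ Y :=
  mkIso (LinearEquiv.ofBijective f.toLin hf) f.comm

lemma bijective_of_isIso {X Y : RightComod k C} (f : X ⟶ Y) [IsIso f] :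
    Function.Bijective f.toLin := by
  refine ⟨Function.LeftInverse.injective (g := (inv f).toLin) fun x => ?_,
    Function.RightInverse.surjective (g := (inv f).toLin) fun x => ?_⟩
  · exact congr_toLin (IsIso.hom_inv_id f) x
  · exact congr_toLin (IsIso.inv_hom_id f) x

/-! ### Kernels of colinear maps. -/

section Kernel

/-- The factorization of a colinear map through an injective colinear map. -/
def liftOfInjective {K X Z : RightComod k C} (i : K ⟶ X) (hi : Function.Injective i.toLin)
    (g : Z ⟶ X) (hg : ∀ z, g.toLin z ∈ LinearMap.range i.toLin) : Z ⟶ K where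
  toLin := (LinearEquiv.ofInjective i.toLin hi).symm.toLinearMap ∘ₗ g.toLin.codRestrict _ hg
  comm z := by
    have h : i.toLin ∘ₗ ((LinearEquiv.ofInjective i.toLin hi).symm.toLinearMap ∘ₗ
        g.toLin.codRestrict _ hg) = g.toLin := LinearMap.ext fun z =>
      congrArg Subtype.val (LinearEquiv.apply_symm_apply (LinearEquiv.ofInjective i.toLin hi)
        (g.toLin.codRestrict _ hg z))
    -- Over a field `i ⊗ id` stays injective, so colinearity may be checked after composing with
    -- `i`, where the lift becomes `g`.
    apply Module.Flat.rTensor_preserves_injective_linearMap (M := C) i.toLin hi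
    rw [← i.comm, ← LinearMap.rTensor_comp_apply, h, ← LinearMap.comp_apply i.toLin, h, g.comm]

lemma liftOfInjective_comp {K X Z : RightComod k C} (i : K ⟶ X)
    (hi : Function.Injective i.toLin) (g : Z ⟶ X)
    (hg : ∀ z, g.toLin z ∈ LinearMap.range i.toLin) : liftOfInjective i hi g hg ≫ i = g :=
  hom_ext (LinearMap.ext fun z => congrArg Subtype.val
    (LinearEquiv.apply_symm_apply (LinearEquiv.ofInjective i.toLin hi)
        (g.toLin.codRestrict _ hg z)))

/-- An injective colinear map onto the kernel of `f` is a kernel of `f`. -/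
def isLimitKernelFork {K X Y : RightComod k C} (i : K ⟶ X) (f : X ⟶ Y) (w : i ≫ f = 0)
    (hi : Function.Injective i.toLin)
    (hf : ∀ x, f.toLin x = 0 → x ∈ LinearMap.range i.toLin) :
    IsLimit (KernelFork.ofι i w) :=
  KernelFork.IsLimit.ofι i w
    (fun g hg => liftOfInjective i hi g fun z => hf _ (congr_toLin hg z))
    (fun g hg => liftOfInjective_comp i hi g _)
    (fun g hg m hm => by
      refine hom_ext (LinearMap.ext fun z => hi ?_)
      exact congr_toLin (hm.trans (liftOfInjective_comp i hi g _).symm) z)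

/-- By flatness the kernel of `f ⊗ id` is `Ker f ⊗ C`, and colinearity of `f` puts `ρ(t)` in that
kernel. -/
lemma ker_coaction {X Y : RightComod k C} (f : X ⟶ Y) :
    ∀ t ∈ LinearMap.ker f.toLin,
      X.ρ t ∈ LinearMap.range ((LinearMap.ker f.toLin).subtype.rTensor C) := by
  intro t ht
  have hex := Module.Flat.rTensor_exact C
    (f := (LinearMap.ker f.toLin).subtype) (g := f.toLin) (LinearMap.exact_subtype_ker_map _)
  refine (hex _).1 ?_
  rw [← f.comm, LinearMap.mem_ker.1 ht, map_zero]

/-- The kernel of a colinear map. -/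
abbrev ker {X Y : RightComod k C} (f : X ⟶ Y) : RightComod k C :=
  sub X (LinearMap.ker f.toLin) (ker_coaction f)

/-- The inclusion of a subcomodule. -/
def subι (X : RightComod k C) (p : Submodule k X)
    (hp : ∀ t ∈ p, X.ρ t ∈ LinearMap.range (p.subtype.rTensor C)) : sub X p hp ⟶ X where
  toLin := p.subtype
  comm t := (subρ_spec hp t).symm

/-- The inclusion of the kernel. -/
abbrev kerι {X Y : RightComod k C} (f : X ⟶ Y) : ker f ⟶ X := subι X _ (ker_coaction f)

lemma kerι_comp {X Y : RightComod k C} (f : X ⟶ Y) : kerι f ≫ f = 0 :=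
  hom_ext (LinearMap.ext fun t => t.2)

/-- The kernel of linear algebra is a categorical kernel. -/
def isLimitKer {X Y : RightComod k C} (f : X ⟶ Y) :
    IsLimit (KernelFork.ofι (kerι f) (kerι_comp f)) :=
  isLimitKernelFork _ f _ Subtype.val_injective fun x hx => ⟨⟨x, hx⟩, rfl⟩

instance : HasKernels (RightComod k C) where
  has_limit f := ⟨⟨⟨_, isLimitKer f⟩⟩⟩

/-- A converse to `isLimitKernelFork`: a categorical kernel is isomorphic to the linear one, over
`X`. It converts left exactness of an abstract functor into statements about elements. -/
lemma injective_of_isLimit {K X Y : RightComod k C} {i : K ⟶ X} {f : X ⟶ Y} {w : i ≫ f = 0}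
    (h : IsLimit (KernelFork.ofι i w)) :
    Function.Injective i.toLin ∧ ∀ x, f.toLin x = 0 → x ∈ LinearMap.range i.toLin := by
  let e := h.conePointUniqueUpToIso (isLimitKer f)
  have he : e.hom ≫ kerι f = i :=
    IsLimit.conePointUniqueUpToIso_hom_comp h (isLimitKer f) WalkingParallelPair.zero
  have hb := bijective_of_isIso e.hom
  have hv : ∀ x, (kerι f).toLin (e.hom.toLin x) = i.toLin x := congr_toLin he
  refine ⟨fun x y hxy => hb.1 (Subtype.val_injective ?_), fun x hx => ?_⟩
  · exact (hv x).trans (hxy.trans (hv y).symm)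
  · obtain ⟨y, hy⟩ := hb.2 ⟨x, hx⟩
    exact ⟨y, (hv y).symm.trans (congrArg Subtype.val hy)⟩

end Kernel

/-! ### Direct sums of comodules as coproducts. -/

section DirectSum

/-- The morphisms `i j : W j ⟶ S` exhibit `S` as the direct sum of the `W j`, with
projections `p j`. -/
structure IsDirectSum {J : Type u} {W : J → RightComod k C} {S : RightComod k C}
    (i : ∀ j, W j ⟶ S) (p : ∀ j, S ⟶ W j) : Prop where
  self : ∀ j, i j ≫ p j = 𝟙 _
  ne : ∀ j j', j ≠ j' → i j ≫ p j' = 0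
  sum : ∀ s : S, ∃ t : Finset J, ∑ j ∈ t, (i j).toLin ((p j).toLin s) = s

namespace IsDirectSum

variable {J : Type u} {W : J → RightComod k C} {S : RightComod k C}
  {i : ∀ j, W j ⟶ S} {p : ∀ j, S ⟶ W j}

lemma self_apply (h : IsDirectSum i p) (j : J) (w : W j) :
    (p j).toLin ((i j).toLin w) = w := congr_toLin (h.self j) w

lemma ne_apply (h : IsDirectSum i p) {j j' : J} (hj : j ≠ j') (w : W j) :
    (p j').toLin ((i j).toLin w) = 0 := congr_toLin (h.ne j j' hj) w

lemma finite (h : IsDirectSum i p) (s : S) : {j | (p j).toLin s ≠ 0}.Finite := by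
  obtain ⟨t, ht⟩ := h.sum s
  refine t.finite_toSet.subset fun j hj => ?_
  by_contra hjt
  refine hj ?_
  rw [← ht, map_sum]
  refine Finset.sum_eq_zero fun j' hj' => h.ne_apply ?_ _
  rintro rfl
  exact hjt hj'

/-- Two linear maps out of a direct sum agree if they agree on the summands. -/
lemma linearMap_ext (h : IsDirectSum i p) {V : Type*} [AddCommGroup V] [Module k V]
    {f g : S →ₗ[k] V} (hfg : ∀ j w, f ((i j).toLin w) = g ((i j).toLin w)) : f = g := by
  ext s
  obtain ⟨t, ht⟩ := h.sum s
  rw [← ht, map_sum, map_sum]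
  exact Finset.sum_congr rfl fun j _ => hfg j _

/-- The linear map out of a direct sum given by linear maps on the summands. -/
def descLin (h : IsDirectSum i p) {V : Type u} [AddCommGroup V] [Module k V]
    (f : ∀ j, W j →ₗ[k] V) : S →ₗ[k] V where
  toFun s := ∑ᶠ j, f j ((p j).toLin s)
  map_add' s s' := by
    -- Finite support is needed for additivity, because `finsum` takes the default value `0` on
    -- infinite supports.
    have hf : ∀ s, (Function.support fun j => f j ((p j).toLin s)).Finite := fun s =>
      (h.finite s).subset fun j hj hj' => hj (by simp [hj'])
    simp only [map_add]
    exact finsum_add_distrib (hf s) (hf s')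
  map_smul' c s := by
    simp only [map_smul, RingHom.id_apply]
    exact (smul_finsum c _).symm

lemma descLin_apply (h : IsDirectSum i p) {V : Type u} [AddCommGroup V] [Module k V]
    (f : ∀ j, W j →ₗ[k] V) (j : J) (w : W j) : h.descLin f ((i j).toLin w) = f j w := by
  refine (finsum_eq_single _ j fun j' hj' => ?_).trans ?_
  · rw [h.ne_apply hj'.symm, map_zero]
  · rw [h.self_apply]

/-- The colinear map out of a direct sum given by colinear maps on the summands. -/
def desc (h : IsDirectSum i p) {Z : RightComod k C} (f : ∀ j, W j ⟶ Z) : S ⟶ Z where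
  toLin := h.descLin fun j => (f j).toLin
  comm s := by
    have : Z.ρ ∘ₗ h.descLin (fun j => (f j).toLin) =
        (h.descLin fun j => (f j).toLin).rTensor C ∘ₗ S.ρ := h.linearMap_ext fun j w => by
      rw [LinearMap.comp_apply, LinearMap.comp_apply, h.descLin_apply, (f j).comm, (i j).comm,
        ← LinearMap.rTensor_comp_apply]
      congr 2
      exact LinearMap.ext fun w => (h.descLin_apply (fun j => (f j).toLin) j w).symm
    exact LinearMap.congr_fun this s

/-- A direct sum is a coproduct. -/
def isColimit (h : IsDirectSum i p) : IsColimit (Cofan.mk S i) :=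
  Cofan.IsColimit.mk _ (fun c => h.desc fun j => c.inj j)
    (fun _ j => hom_ext (LinearMap.ext fun w => h.descLin_apply _ j w))
    (fun c _ hm => hom_ext (h.linearMap_ext fun j w =>
      (congr_toLin (hm j) w).trans (h.descLin_apply (fun j => (c.inj j).toLin) j w).symm))

end IsDirectSum

lemma assoc_rTensor_rTensor {V V' P Q : Type u} [AddCommGroup V] [Module k V]
    [AddCommGroup V'] [Module k V'] [AddCommGroup P] [Module k P] [AddCommGroup Q] [Module k Q]
    (f : V →ₗ[k] V') (z : (V ⊗[k] P) ⊗[k] Q) :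
    TensorProduct.assoc k V' P Q ((f.rTensor P).rTensor Q z) =
      f.rTensor (P ⊗[k] Q) (TensorProduct.assoc k V P Q z) := by
  have : (TensorProduct.assoc k V' P Q).toLinearMap ∘ₗ (f.rTensor P).rTensor Q =
      f.rTensor (P ⊗[k] Q) ∘ₗ (TensorProduct.assoc k V P Q).toLinearMap :=
    TensorProduct.ext_threefold fun _ _ _ => rfl
  exact LinearMap.congr_fun this z

lemma lTensor_rTensor_comm {V V' P P' : Type u} [AddCommGroup V] [Module k V]
    [AddCommGroup V'] [Module k V'] [AddCommGroup P] [Module k P] [AddCommGroup P'] [Module k P']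
    (f : V →ₗ[k] V') (g : P →ₗ[k] P') (z : V ⊗[k] P) :
    g.lTensor V' (f.rTensor P z) = f.rTensor P' (g.lTensor V z) := by
  rw [← LinearMap.comp_apply, ← LinearMap.comp_apply, LinearMap.lTensor_comp_rTensor,
    LinearMap.rTensor_comp_lTensor]

lemma rid_rTensor {V V' : Type u} [AddCommGroup V] [Module k V] [AddCommGroup V'] [Module k V']
    (f : V →ₗ[k] V') (z : V ⊗[k] k) :
    TensorProduct.rid k V' (f.rTensor k z) = f (TensorProduct.rid k V z) := by
  have : (TensorProduct.rid k V').toLinearMap ∘ₗ f.rTensor k =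
      f ∘ₗ (TensorProduct.rid k V).toLinearMap :=
    TensorProduct.ext' fun x r => by simp
  exact LinearMap.congr_fun this z

section

variable {J : Type u} (W : J → RightComod k C)

open Classical in
/-- The inclusion of a summand into the direct sum as a linear map. -/
def sumLof (j : J) : (W j).carrier →ₗ[k] DirectSum J fun j => (W j).carrier :=
  DirectSum.lof k J (fun j => (W j).carrier) j

/-- The projection of the direct sum to a summand as a linear map. -/
def sumComponent (j : J) : (DirectSum J fun j => (W j).carrier) →ₗ[k] (W j).carrier :=
  DirectSum.component k J (fun j => (W j).carrier) j

lemma sumComponent_self (j : J) : sumComponent W j ∘ₗ sumLof W j = LinearMap.id := by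
  classical
  exact LinearMap.ext fun w => DirectSum.component.lof_self (M := fun j => (W j).carrier) k j w

lemma sumComponent_ne {j j' : J} (h : j ≠ j') : sumComponent W j' ∘ₗ sumLof W j = 0 := by
  classical
  refine LinearMap.ext fun w => (DirectSum.component.of (M := fun j => (W j).carrier) k j' j w).trans ?_
  rw [dif_neg h]
  rfl

variable {W} in
lemma sumLof_ext {V : Type*} [AddCommGroup V] [Module k V]
    {f g : (DirectSum J fun j => (W j).carrier) →ₗ[k] V}
    (h : ∀ j, f ∘ₗ sumLof W j = g ∘ₗ sumLof W j) : f = g := by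
  classical
  exact DirectSum.linearMap_ext k h

open Classical in
/-- The coaction on a direct sum. -/
def directSumρ : (DirectSum J fun j => (W j).carrier) →ₗ[k]
    (DirectSum J fun j => (W j).carrier) ⊗[k] C :=
  DirectSum.toModule k J _ fun j => (sumLof W j).rTensor C ∘ₗ (W j).ρ

lemma directSumρ_comp (j : J) :
    directSumρ W ∘ₗ sumLof W j = (sumLof W j).rTensor C ∘ₗ (W j).ρ := by
  classical
  exact LinearMap.ext fun w => DirectSum.toModule_lof
    (φ := fun j => (sumLof W j).rTensor C ∘ₗ (W j).ρ) k j w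

end

/-- The direct sum of a family of comodules. -/
abbrev directSum {J : Type u} (W : J → RightComod k C) : RightComod k C where
  carrier := DirectSum J fun j => (W j).carrier
  ρ := directSumρ W
  coassoc m := by
    have : (TensorProduct.assoc k _ C C).toLinearMap ∘ₗ (directSumρ W).rTensor C ∘ₗ
        directSumρ W = (Coalgebra.comul (R := k) (A := C)).lTensor _ ∘ₗ directSumρ W := by
      refine sumLof_ext fun j => LinearMap.ext fun w => ?_
      have h := LinearMap.congr_fun (directSumρ_comp W j) w
      simp only [LinearMap.comp_apply, LinearEquiv.coe_coe] at h ⊢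
      rw [h, ← LinearMap.rTensor_comp_apply, directSumρ_comp, LinearMap.rTensor_comp_apply,
        assoc_rTensor_rTensor, (W j).coassoc, lTensor_rTensor_comm]
    exact LinearMap.congr_fun this m
  counit m := by
    have : (TensorProduct.rid k _).toLinearMap ∘ₗ
        (Coalgebra.counit (R := k) (A := C)).lTensor _ ∘ₗ directSumρ W = LinearMap.id := by
      refine sumLof_ext fun j => LinearMap.ext fun w => ?_
      have h := LinearMap.congr_fun (directSumρ_comp W j) w
      simp only [LinearMap.comp_apply, LinearEquiv.coe_coe] at h ⊢
      rw [h, lTensor_rTensor_comm, rid_rTensor, (W j).counit]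
      rfl
    exact LinearMap.congr_fun this m

/-- The inclusion of a summand into the direct sum. -/
def directSumι {J : Type u} (W : J → RightComod k C) (j : J) : W j ⟶ directSum W where
  toLin := sumLof W j
  comm w := LinearMap.congr_fun (directSumρ_comp W j) w

/-- The projection of the direct sum to a summand. -/
def directSumπ {J : Type u} (W : J → RightComod k C) (j : J) : directSum W ⟶ W j where
  toLin := sumComponent W j
  comm s := by
    have : (W j).ρ ∘ₗ sumComponent W j = (sumComponent W j).rTensor C ∘ₗ directSumρ W := by
      refine sumLof_ext fun j' => ?_
      rw [LinearMap.comp_assoc, LinearMap.comp_assoc, directSumρ_comp, ← LinearMap.comp_assoc _ _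
        (LinearMap.rTensor _ _), ← LinearMap.rTensor_comp]
      by_cases h : j' = j
      · subst h
        rw [sumComponent_self, LinearMap.rTensor_id]
        rfl
      · rw [sumComponent_ne W h, LinearMap.rTensor_zero]
        simp
    exact LinearMap.congr_fun this s

lemma isDirectSum_directSum {J : Type u} (W : J → RightComod k C) :
    IsDirectSum (directSumι W) (directSumπ W) where
  self j := hom_ext (sumComponent_self W j)
  ne j j' h := hom_ext (sumComponent_ne W h)
  sum s := by
    classical
    exact ⟨DFinsupp.support s, DirectSum.sum_support_of (β := fun j => (W j : Type u)) s⟩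

instance hasColimitsOfShape_discrete (J : Type u) :
    HasColimitsOfShape (Discrete J) (RightComod k C) where
  has_colimit F :=
    have : HasColimit (Discrete.functor (F.obj ∘ Discrete.mk)) :=
      ⟨⟨⟨_, (isDirectSum_directSum (F.obj ∘ Discrete.mk)).isColimit⟩⟩⟩
    hasColimit_of_iso Discrete.natIsoFunctor

end DirectSum

/-! ### Zero object, biproducts and equalizers, needed for the kernel criterion of left exactness.
-/

section Instances

/-- The zero comodule. -/
abbrev zeroComod (k : Type u) [Field k] (C : Type u) [AddCommGroup C] [Module k C]
    [Coalgebra k C] : RightComod k C where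
  carrier := PUnit
  ρ := 0
  coassoc m := by simp
  counit m := rfl

instance : HasZeroObject (RightComod k C) where
  zero := ⟨zeroComod k C, (IsZero.iff_id_eq_zero _).2 (hom_ext (LinearMap.ext fun _ => rfl))⟩

instance : HasFiniteCoproducts (RightComod k C) where
  out n :=
    -- The coproducts constructed above are indexed by types in universe `u`, hence the lift of `Fin
    -- n`.
    hasColimitsOfShape_of_equivalence (Discrete.equivalence Equiv.ulift : Discrete (ULift.{u} (Fin n)) ≌ _)

instance : HasFiniteBiproducts (RightComod k C) := HasFiniteBiproducts.of_hasFiniteCoproducts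

instance : HasBinaryBiproducts (RightComod k C) := hasBinaryBiproducts_of_finite_biproducts _

instance : HasEqualizers (RightComod k C) := Preadditive.hasEqualizers_of_hasKernels

end Instances

end Comodules

end RightComod

/-! ### Cotensor functors are linear, left exact and preserve coproducts. -/

section CotensorExact

open RightComod

variable {k : Type u} [Field k]
variable {C : Type u} [AddCommGroup C] [Module k C] [Coalgebra k C]
variable {D : Type u} [AddCommGroup D] [Module k D] [Coalgebra k D]

instance (M : Bicomod k C D) : (cotensorFunctor M).Additive where
  map_add {X Y f g} := cotensor_hom_ext fun (t : cotensor X M) => by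
    change TensorProduct.map (f.toLin + g.toLin) LinearMap.id t.1 =
      TensorProduct.map f.toLin LinearMap.id t.1 + TensorProduct.map g.toLin LinearMap.id t.1
    rw [TensorProduct.map_add_left, LinearMap.add_apply]

instance (M : Bicomod k C D) : (cotensorFunctor M).Linear k where
  map_smul {X Y} f r := cotensor_hom_ext fun (t : cotensor X M) => by
    change TensorProduct.map (r • f.toLin) LinearMap.id t.1 =
      r • TensorProduct.map f.toLin LinearMap.id t.1
    rw [TensorProduct.map_smul_left, LinearMap.smul_apply]

/-- The orthogonality relations survive any additive functor. Only the finite decomposition of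
elements is specific to the cotensor product, and it is inherited from `S ⊗ M`. -/
lemma isDirectSum_cotensor (M : Bicomod k C D) {J : Type u} {W : J → RightComod k C}
    {S : RightComod k C} {i : ∀ j, W j ⟶ S} {p : ∀ j, S ⟶ W j} (h : IsDirectSum i p) :
    IsDirectSum (fun j => (cotensorFunctor M).map (i j)) (fun j => (cotensorFunctor M).map (p j))
    where
  self j := by rw [← Functor.map_comp, h.self, CategoryTheory.Functor.map_id]
  ne j j' hj := by rw [← Functor.map_comp, h.ne _ _ hj, Functor.map_zero]
  sum := fun (t : cotensor S M) => by
    classical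
    -- Asking for every `B ⊇ A` makes the claim additive in `z`: two index sets can be replaced by
    -- their union.
    have key : ∀ z : S ⊗[k] M, ∃ A : Finset J, ∀ B, A ⊆ B →
        ∑ j ∈ B, (i j).toLin.rTensor M ((p j).toLin.rTensor M z) = z := by
      intro z
      induction z with
      | zero => exact ⟨∅, by simp⟩
      | add a b ha hb =>
        obtain ⟨A, hA⟩ := ha
        obtain ⟨A', hA'⟩ := hb
        refine ⟨A ∪ A', fun B hB => ?_⟩
        simp only [map_add, Finset.sum_add_distrib]
        rw [hA B (Finset.union_subset_left hB), hA' B (Finset.union_subset_right hB)]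
      | tmul s m =>
        obtain ⟨A, hA⟩ := h.sum s
        refine ⟨A, fun B hB => ?_⟩
        simp only [LinearMap.rTensor_tmul]
        rw [← TensorProduct.sum_tmul]
        congr 1
        refine (Finset.sum_subset hB fun j _ hj => ?_).symm.trans hA
        -- For `j` outside `A`, the component `p j s` vanishes, since `s` is a sum of elements of
        -- the summands indexed by `A`.
        rw [← hA, map_sum, Finset.sum_eq_zero (s := A), map_zero]
        intro j' hj'
        exact h.ne_apply (by rintro rfl; exact hj hj') _
    obtain ⟨A, hA⟩ := key t.1
    refine ⟨A, Subtype.ext ?_⟩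
    refine Eq.trans ?_ (hA A subset_rfl)
    exact map_sum (cotensor S M).subtype _ _

instance (M : Bicomod k C D) (J : Type u) :
    PreservesColimitsOfShape (Discrete J) (cotensorFunctor M) where
  preservesColimit {K} := by
    have : PreservesColimit (Discrete.functor (K.obj ∘ Discrete.mk)) (cotensorFunctor M) :=
      preservesColimit_of_preserves_colimit_cocone
        (isDirectSum_directSum (K.obj ∘ Discrete.mk)).isColimit
        ((isColimitMapCoconeCofanMkEquiv _ _ _).symm
          (isDirectSum_cotensor M (isDirectSum_directSum (K.obj ∘ Discrete.mk))).isColimit)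
    exact preservesColimit_of_iso_diagram _ Discrete.natIsoFunctor.symm

/-- For an additive functor it suffices to preserve kernels. An element of `X □ M` killed by `f ⊗
id` comes from `Ker f ⊗ M` by flatness, and it satisfies the cotensor equation already there. -/
instance (M : Bicomod k C D) : PreservesFiniteLimits (cotensorFunctor M) := by
  have : ∀ {X Y : RightComod k C} (f : X ⟶ Y),
      PreservesLimit (parallelPair f 0) (cotensorFunctor M) := fun {X Y} f => by
    refine preservesLimit_of_preserves_limit_cone (isLimitKer f)
      ((KernelFork.isLimitMapConeEquiv _ _).symm ?_)
    have hi : ∀ V : Type u, ∀ [AddCommGroup V], ∀ [Module k V],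
      Function.Injective ((kerι f).toLin.rTensor V) := fun V _ _ =>
        X.rTensor_subtype_injective (LinearMap.ker f.toLin) V
    refine isLimitKernelFork ((cotensorFunctor M).map (kerι f)) ((cotensorFunctor M).map f)
      (by rw [← Functor.map_comp, kerι_comp, Functor.map_zero]) ?_ ?_
    · intro (s : cotensor _ M) (t : cotensor _ M) hst
      exact Subtype.ext (hi M (congrArg Subtype.val hst))
    · intro (t : cotensor X M) ht
      have hex := Module.Flat.rTensor_exact M
        (f := (LinearMap.ker f.toLin).subtype) (g := f.toLin) (LinearMap.exact_subtype_ker_map _)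
      obtain ⟨s, hs⟩ := (hex t.1).1 (congrArg Subtype.val ht)
      refine ⟨(⟨s, mem_cotensor.2 ?_⟩ : cotensor (ker f) M), Subtype.ext hs⟩
      -- The cotensor equation for `s` lives in `Ker f ⊗ (C ⊗ M)`, which embeds in `X ⊗ (C ⊗ M)`,
      -- where it is the known equation for `t`.
      apply hi
      have h1 := mem_cotensor.1 t.2
      have h2 : (kerι f).toLin.rTensor M s = t.1 := hs
      rw [← h2, lTensor_rTensor_comm, ← LinearMap.rTensor_comp_apply] at h1
      rw [← h1, ← assoc_rTensor_rTensor, ← LinearMap.rTensor_comp_apply]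
      congr 3
      exact LinearMap.ext fun z => ((kerι f).comm z).symm
  exact Functor.preservesFiniteLimits_of_preservesKernels _

lemma isTypeL_cotensorFunctor (M : Bicomod k C D) : IsTypeL (cotensorFunctor M) where
  additive := inferInstance
  linear := inferInstance
  leftExact := inferInstance
  coproducts _ := inferInstance

end CotensorExact

namespace RightComod

/-! ### Tensor products of a vector space and a comodule; cofree comodules. -/

section VecTensor

variable {k : Type u} [Field k] {C : Type u} [AddCommGroup C] [Module k C] [Coalgebra k C]

/-- A right comodule as a bicomodule over the trivial coalgebra on the left. -/
abbrev toBicomod (X : RightComod k C) : Bicomod k k C where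
  carrier := X
  ρl := (TensorProduct.lid k X).symm.toLinearMap
  ρr := X.ρ
  coassoc_left m := by simp
  counit_left m := by simp
  coassoc_right := X.coassoc
  counit_right := X.counit
  compat m := by
    have : (TensorProduct.assoc k k X C).toLinearMap ∘ₗ
        (TensorProduct.lid k X).symm.toLinearMap.rTensor C =
        (TensorProduct.lid k (X ⊗[k] C)).symm.toLinearMap :=
      TensorProduct.ext' fun x c => by simp
    exact LinearMap.congr_fun this (X.ρ m)

/-- A vector space as a comodule over the trivial coalgebra. -/
abbrev ofModule (k : Type u) [Field k] (U : Type u) [AddCommGroup U] [Module k U] :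
    RightComod k k where
  carrier := U
  ρ := (TensorProduct.rid k U).symm.toLinearMap
  coassoc m := by simp
  counit m := by simp

variable (U U' : Type u) [AddCommGroup U] [Module k U] [AddCommGroup U'] [Module k U']

/-- The tensor product `U ⊗ X` of a vector space and a comodule. -/
abbrev vecTensor (X : RightComod k C) : RightComod k C where
  carrier := U ⊗[k] X
  ρ := (TensorProduct.assoc k U X C).symm.toLinearMap ∘ₗ X.ρ.lTensor U
  coassoc := (freeTensor (ofModule k U) X.toBicomod).coassoc
  counit := (freeTensor (ofModule k U) X.toBicomod).counit

variable {U U'}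

lemma vecTensor_ρ_tmul (X : RightComod k C) (v : U) (x : X) :
    (vecTensor U X).ρ (v ⊗ₜ[k] x) = (TensorProduct.mk k U X v).rTensor C (X.ρ x) := by
  change (TensorProduct.assoc k U X C).symm (v ⊗ₜ[k] X.ρ x) = _
  have : (TensorProduct.assoc k U X C).symm.toLinearMap ∘ₗ TensorProduct.mk k U (X ⊗[k] C) v =
      (TensorProduct.mk k U X v).rTensor C := TensorProduct.ext' fun x c => by simp
  exact LinearMap.congr_fun this (X.ρ x)

/-- The colinear map `f ⊗ g` between tensor products of vector spaces and comodules. -/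
def vecMap {X X' : RightComod k C} (f : U →ₗ[k] U') (g : X ⟶ X') :
    vecTensor U X ⟶ vecTensor U' X' where
  toLin := TensorProduct.map f g.toLin
  comm t := by
    have : (vecTensor U' X').ρ ∘ₗ TensorProduct.map f g.toLin =
        (TensorProduct.map f g.toLin).rTensor C ∘ₗ (vecTensor U X).ρ :=
      TensorProduct.ext' fun v x => by
        refine (vecTensor_ρ_tmul X' (f v) (g.toLin x)).trans (Eq.trans ?_
          (congrArg ((TensorProduct.map f g.toLin).rTensor C) (vecTensor_ρ_tmul X v x)).symm)
        rw [g.comm, ← LinearMap.rTensor_comp_apply, ← LinearMap.rTensor_comp_apply]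
        rfl
    exact LinearMap.congr_fun this t

/-- The colinear map `x ↦ v ⊗ x`. -/
def insert (X : RightComod k C) (v : U) : X ⟶ vecTensor U X where
  toLin := TensorProduct.mk k U X v
  comm := vecTensor_ρ_tmul X v

/-- The coaction of `W` as a colinear map to the cofree comodule on `W`. -/
def coactionHom (W : RightComod k C) : W ⟶ vecTensor W (regular k C) where
  toLin := W.ρ
  comm w := by
    -- Colinearity of the coaction into the cofree comodule is coassociativity, read through the
    -- associator.
    apply (TensorProduct.assoc k W C C).injective
    exact (LinearEquiv.apply_symm_apply _ _).trans (W.coassoc w).symm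

lemma counit_rTensor_coaction (W : RightComod k C) {V : Type u} [AddCommGroup V] [Module k V]
    (z : W ⊗[k] V) :
    ((TensorProduct.rid k W).toLinearMap ∘ₗ
      (Coalgebra.counit (R := k) (A := C)).lTensor W).rTensor V (W.ρ.rTensor V z) = z := by
  rw [← LinearMap.rTensor_comp_apply]
  have : ((TensorProduct.rid k W).toLinearMap ∘ₗ
      (Coalgebra.counit (R := k) (A := C)).lTensor W) ∘ₗ W.ρ = LinearMap.id :=
    LinearMap.ext W.counit
  rw [this, LinearMap.rTensor_id, LinearMap.id_apply]

end VecTensor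

end RightComod

open RightComod

/-! ### Natural families of linear maps are determined at the coalgebra. -/

section Formula

variable {k : Type u} [Field k]
variable {C : Type u} [AddCommGroup C] [Module k C] [Coalgebra k C]
variable {D : Type u} [AddCommGroup D] [Module k D] [Coalgebra k D]
variable {V : Type u} [AddCommGroup V] [Module k V]

/-- The left coaction as a map from `M` to `C □_C M`. -/
def coactCotensor (M : Bicomod k C D) : M →ₗ[k] cotensor (regular k C) M :=
  M.ρl.codRestrict _ fun m => mem_cotensor.2 (M.coassoc_left m)

variable (V) in
/-- The map `a ⊗ v ↦ α(a) v` determined by a functional `α`. -/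
def evalL {A : Type u} [AddCommGroup A] [Module k A] (α : A →ₗ[k] k) : A ⊗[k] V →ₗ[k] V :=
  (TensorProduct.lid k V).toLinearMap ∘ₗ α.rTensor V

@[simp] lemma evalL_tmul {A : Type u} [AddCommGroup A] [Module k A] (α : A →ₗ[k] k) (a : A)
    (v : V) : evalL V α (a ⊗ₜ[k] v) = α a • v := rfl

/-- With counits for `α` and `β`, this recovers the operation `γ` from the formula `x ⊗ (w ⊗ m) ↦
(x₀ ⊗ w) ⊗ γ(x₁, m)`. -/
lemma evalL_map₂ {A A' B B' : Type u} [AddCommGroup A] [Module k A] [AddCommGroup A'] [Module k A']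
    [AddCommGroup B] [Module k B] [AddCommGroup B'] [Module k B'] (α : A →ₗ[k] k) (β : B →ₗ[k] k)
    (γ : A' →ₗ[k] B' →ₗ[k] V) (a : A ⊗[k] A') (b : B ⊗[k] B') :
    evalL V (LinearMap.mul' k k ∘ₗ TensorProduct.map α β)
      (TensorProduct.map₂ (TensorProduct.mk k A B) γ a b) = γ (evalL A' α a) (evalL B' β b) := by
  induction a with
  | zero => simp
  | add a a' ha ha' => simp only [map_add, LinearMap.add_apply, ha, ha']
  | tmul x z =>
    induction b with
    | zero => simp
    | add b b' hb hb' => simp only [map_add, hb, hb']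
    | tmul y p =>
      simp only [TensorProduct.map₂_apply_tmul, TensorProduct.mk_apply, evalL_tmul,
        LinearMap.comp_apply, TensorProduct.map_tmul, LinearMap.mul'_apply, map_smul,
        LinearMap.smul_apply, mul_smul]
      exact smul_comm _ _ _

lemma evalL_lTensor {A V' : Type u} [AddCommGroup A] [Module k A] [AddCommGroup V'] [Module k V']
    (α : A →ₗ[k] k) (g : V →ₗ[k] V') (z : A ⊗[k] V) :
    evalL V' α (g.lTensor A z) = g (evalL V α z) := by
  have : evalL V' α ∘ₗ g.lTensor A = g ∘ₗ evalL V α := TensorProduct.ext' fun a v => by simp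
  exact LinearMap.congr_fun this z

lemma evalL_assoc {A W : Type u} [AddCommGroup A] [Module k A] [AddCommGroup W] [Module k W]
    (α : A →ₗ[k] k) (z : (A ⊗[k] W) ⊗[k] V) :
    evalL (W ⊗[k] V) α (TensorProduct.assoc k A W V z) = (evalL W α).rTensor V z := by
  have : evalL (W ⊗[k] V) α ∘ₗ (TensorProduct.assoc k A W V).toLinearMap =
      (evalL W α).rTensor V := TensorProduct.ext_threefold fun a w v => by
    simp [TensorProduct.smul_tmul']
  exact LinearMap.congr_fun this z

variable (C V) in
/-- The map `c ⊗ v ↦ ε(c) v`. -/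
abbrev counitL : C ⊗[k] V →ₗ[k] V := evalL V (Coalgebra.counit (R := k) (A := C))

lemma counitL_ρl (M : Bicomod k C D) (m : M) : counitL C M (M.ρl m) = m := M.counit_left m

lemma counit_assoc_symm {W : Type u} [AddCommGroup W] [Module k W] (z : W ⊗[k] (C ⊗[k] V)) :
    ((TensorProduct.rid k W).toLinearMap ∘ₗ
      (Coalgebra.counit (R := k) (A := C)).lTensor W).rTensor V
        ((TensorProduct.assoc k W C V).symm z) = (counitL C V).lTensor W z := by
  have : ((TensorProduct.rid k W).toLinearMap ∘ₗ
      (Coalgebra.counit (R := k) (A := C)).lTensor W).rTensor V ∘ₗ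
        (TensorProduct.assoc k W C V).symm.toLinearMap = (counitL C V).lTensor W := by
    refine (LinearMap.cancel_right (TensorProduct.assoc k W C V).surjective).1 ?_
    refine TensorProduct.ext_threefold fun w c v => ?_
    simp [TensorProduct.smul_tmul]
  exact LinearMap.congr_fun this z

/-- A family of linear maps `X → X ⊗ V`, natural in the comodule `X`, is given by a linear map
from the coalgebra to `V`. -/
lemma natural_coaction_formula (ζ : ∀ X : RightComod k C, X →ₗ[k] X ⊗[k] V)
    (hζ : ∀ {X X' : RightComod k C} (f : X ⟶ X') (x : X),
      ζ X' (f.toLin x) = f.toLin.rTensor V (ζ X x)) (X : RightComod k C) (x : X) :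
    ζ X x = (counitL C V ∘ₗ ζ (regular k C)).lTensor X (X.ρ x) := by
  -- On the cofree comodule `X ⊗ C`, naturality along the colinear maps `c ↦ x ⊗ c` reduces `ζ` to
  -- its value at `C`.
  have h1 : ζ (vecTensor X (regular k C)) =
      (TensorProduct.assoc k X C V).symm.toLinearMap ∘ₗ (ζ (regular k C)).lTensor X :=
    TensorProduct.ext' fun x c => by
      refine (hζ (insert (regular k C) x) c).trans ?_
      have : (TensorProduct.assoc k X C V).symm.toLinearMap ∘ₗ TensorProduct.mk k X (C ⊗[k] V) x =
          (TensorProduct.mk k X C x).rTensor V := TensorProduct.ext' fun c v => by simp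
      exact (LinearMap.congr_fun this _).symm
  -- The counit undoes the coaction on the first tensorand, so both sides may be compared in `(X ⊗
  -- C) ⊗ V`; there naturality along the coaction `X ⟶ X ⊗ C` applies.
  rw [← counit_rTensor_coaction X (ζ X x), LinearMap.lTensor_comp_apply, ← counit_assoc_symm]
  congr 1
  exact (hζ (coactionHom X) x).symm.trans (LinearMap.congr_fun h1 (X.ρ x))

/-- The linear map underlying a natural family of linear maps on the cotensor product. -/
def naturalGerm {M : Bicomod k C D} (η : ∀ W : RightComod k C, cotensor W M →ₗ[k] W ⊗[k] V) :
    M →ₗ[k] V :=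
  counitL C V ∘ₗ η (regular k C) ∘ₗ coactCotensor M

/-- A family of linear maps `W □_C M → W ⊗ V`, natural in the comodule `W`, is given by a linear
map `M → V`. -/
lemma natural_cotensor_formula {M : Bicomod k C D}
    (η : ∀ W : RightComod k C, cotensor W M →ₗ[k] W ⊗[k] V)
    (hη : ∀ {W W' : RightComod k C} (f : W ⟶ W') (t : cotensor W M),
      η W' ((cotensorHom f (𝟙 M)).toLin t) = f.toLin.rTensor V (η W t))
    (W : RightComod k C) (t : cotensor W M) :
    η W t = (naturalGerm η).lTensor W t.1 := by
  have hmk : ∀ (P : Type u) [AddCommGroup P] [Module k P] (w : W),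
      (TensorProduct.assoc k W C P).symm.toLinearMap ∘ₗ TensorProduct.mk k W (C ⊗[k] P) w =
          (TensorProduct.mk k W C w).rTensor P :=
    fun P _ _ w => TensorProduct.ext' fun c v => by simp
  -- The map `w ⊗ m ↦ w ⊗ ρˡ(m)` takes values in `(W ⊗ C) □ M`: for fixed `w` it is the coaction `M
  -- → C □ M` followed by the map induced by `c ↦ w ⊗ c`. Those factors also determine `η` on its
  -- image.
  have hΛ : ∀ z : W ⊗[k] M, (TensorProduct.assoc k W C M).symm (M.ρl.lTensor W z) ∈
      cotensor (vecTensor W (regular k C)) M := by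
    intro z
    induction z with
    | zero => simp
    | add a b ha hb => rw [map_add, map_add]; exact add_mem ha hb
    | tmul w m =>
      have := ((cotensorHom (insert (regular k C) w) (𝟙 M)).toLin (coactCotensor M m)).2
      exact (LinearMap.congr_fun (hmk M w) (M.ρl m)) ▸ this
  let Λ : W ⊗[k] M →ₗ[k] cotensor (vecTensor W (regular k C)) M :=
    ((TensorProduct.assoc k W C M).symm.toLinearMap ∘ₗ M.ρl.lTensor W).codRestrict _ hΛ
  have hΛ' : ∀ w m, Λ (w ⊗ₜ m) =
      (cotensorHom (insert (regular k C) w) (𝟙 M)).toLin (coactCotensor M m) := fun w m =>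
    Subtype.ext (LinearMap.congr_fun (hmk M w) (M.ρl m))
  have h1 : η (vecTensor W (regular k C)) ∘ₗ Λ =
      (TensorProduct.assoc k W C V).symm.toLinearMap ∘ₗ
        (η (regular k C) ∘ₗ coactCotensor M).lTensor W := by
    refine TensorProduct.ext' fun w m => ?_
    rw [LinearMap.comp_apply, hΛ']
    exact (hη (insert (regular k C) w) (coactCotensor M m)).trans
      (LinearMap.congr_fun (hmk V w) _).symm
  rw [← counit_rTensor_coaction W (η W t), naturalGerm, LinearMap.lTensor_comp_apply,
    ← counit_assoc_symm]
  congr 1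
  -- On `W □ M` the map induced by the coaction of `W` agrees with `Λ`; this is the defining
  -- equation of the cotensor product.
  refine (hη (coactionHom W) t).symm.trans (Eq.trans ?_ (LinearMap.congr_fun h1 t.1))
  refine congrArg (η (vecTensor W (regular k C))) (Subtype.ext ?_)
  apply (TensorProduct.assoc k W C M).injective
  exact (mem_cotensor.1 t.2).trans (LinearEquiv.apply_symm_apply _ _).symm

end Formula

/-! ### Takeuchi's functor is fully faithful. -/

section FullyFaithful

variable {k : Type u} [Field k]
variable {C : Type u} [AddCommGroup C] [Module k C] [Coalgebra k C]
variable {D : Type u} [AddCommGroup D] [Module k D] [Coalgebra k D]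

/-- The right comodule underlying a bicomodule. -/
abbrev Bicomod.right (M : Bicomod k C D) : RightComod k D where
  carrier := M
  ρ := M.ρr
  coassoc := M.coassoc_right
  counit := M.counit_right

/-- The left coaction as a colinear map `M ⟶ C □_C M`. -/
def coactHom (M : Bicomod k C D) : M.right ⟶ cotensorObj (regular k C) M where
  toLin := coactCotensor M
  comm m := by
    apply rTensor_subtype_injective (freeTensor (regular k C) M) (cotensor (regular k C) M)
    refine (subρ_spec (X := freeTensor (regular k C) M)
      (cotensor_coaction (regular k C) M) (coactCotensor M m)).trans ?_
    rw [← LinearMap.rTensor_comp_apply]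
    apply (TensorProduct.assoc k C M D).injective
    exact (LinearEquiv.apply_symm_apply _ _).trans (M.compat m).symm

/-- Applying a functional to the first tensorand of `U ⊗ X` is colinear. -/
def evalVec {U : Type u} [AddCommGroup U] [Module k U] (X : RightComod k D) (α : U →ₗ[k] k) :
    vecTensor U X ⟶ X where
  toLin := evalL X α
  comm t := by
    have h : X.ρ ∘ₗ evalL X α = (evalL X α).rTensor D ∘ₗ (vecTensor U X).ρ :=
      TensorProduct.ext' fun v x => by
        refine Eq.trans ?_ (congrArg ((evalL X α).rTensor D) (vecTensor_ρ_tmul X v x)).symm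
        have : evalL X α ∘ₗ TensorProduct.mk k U X v = α v • LinearMap.id :=
          LinearMap.ext fun m => rfl
        rw [← LinearMap.rTensor_comp_apply, this, LinearMap.rTensor_smul, LinearMap.comp_apply]
        simp
    exact LinearMap.congr_fun h t

/-- Applying a functional to the first tensorand of `W □_C M` is right colinear. -/
def evalHom (W : RightComod k C) (M : Bicomod k C D) (α : W →ₗ[k] k) :
    cotensorObj W M ⟶ M.right :=
  subι (freeTensor W M) (cotensor W M) (cotensor_coaction W M) ≫ evalVec M.right α

lemma counitL_assoc_comul {V : Type u} [AddCommGroup V] [Module k V] (z : C ⊗[k] V) :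
    counitL C (C ⊗[k] V) (TensorProduct.assoc k C C V
      ((Coalgebra.comul (R := k) (A := C)).rTensor V z)) = z := by
  rw [evalL_assoc, ← LinearMap.rTensor_comp_apply]
  have : counitL C C ∘ₗ Coalgebra.comul (R := k) (A := C) = LinearMap.id :=
    LinearMap.ext fun c => by simp [evalL]
  rw [this, LinearMap.rTensor_id, LinearMap.id_apply]

/-- Applying `ε` to the first tensorand of the cotensor equation turns `(id ⊗ ρˡ)t` into `ρˡ((ε ⊗
id)t)` and `(Δ ⊗ id)t` into `t`. Together with the counit axiom this is the identification of `N`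
with `C □ N`. -/
lemma ρl_counitL {N : Bicomod k C D} (t : cotensor (regular k C) N) :
    N.ρl (counitL C N t.1) = t.1 := by
  rw [← evalL_lTensor]
  exact (congrArg _ (mem_cotensor.1 t.2).symm).trans (counitL_assoc_comul t.1)

/-- The morphism of bicomodules underlying a natural transformation of cotensor functors. -/
def bicomodHomOfNatTrans {M N : Bicomod k C D} (η : cotensorFunctor M ⟶ cotensorFunctor N) :
    M ⟶ N where
  toLin := (coactHom M ≫ η.app (regular k C) ≫ evalHom (regular k C) N Coalgebra.counit).toLin
  comm_left m := by
    -- At `W = C` the formula says `η(ρˡ m) = (id ⊗ g)(ρˡ m)` for the map `g` being defined, while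
    -- `ρl_counitL` says that the left side is `ρˡ(g m)`.
    have h := natural_cotensor_formula
      (fun W => (cotensor W N).subtype ∘ₗ (η.app W).toLin)
      (fun f t => congrArg Subtype.val (congr_toLin (η.naturality f) t)) (regular k C)
      (coactCotensor M m)
    exact (ρl_counitL ((η.app (regular k C)).toLin (coactCotensor M m))).trans h
  comm_right := (coactHom M ≫ η.app (regular k C) ≫
    evalHom (regular k C) N Coalgebra.counit).comm

lemma natTrans_apply {M N : Bicomod k C D} (η : cotensorFunctor M ⟶ cotensorFunctor N)
    (W : RightComod k C) (t : cotensor W M) :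
    ((η.app W).toLin t : cotensor W N).1 = (bicomodHomOfNatTrans η).toLin.lTensor W t.1 :=
  natural_cotensor_formula (fun W => (cotensor W N).subtype ∘ₗ (η.app W).toLin)
      (fun f t => congrArg Subtype.val (congr_toLin (η.naturality f) t)) W t

instance : (takeuchiFunctor k C D).Full where
  map_surjective {M _} η := ⟨bicomodHomOfNatTrans η, NatTrans.ext <| funext fun W =>
    cotensor_hom_ext fun (t : cotensor W M) => (natTrans_apply η W t).symm⟩

/-- The component at `C`, evaluated on `ρˡ(m)` and followed by the counit, returns the value of the
bicomodule map at `m`. -/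
instance : (takeuchiFunctor k C D).Faithful where
  map_injective {M N} f g h := by
    refine Bicomod.hom_ext (LinearMap.ext fun m => ?_)
    have h1 : f.toLin.lTensor C (M.ρl m) = g.toLin.lTensor C (M.ρl m) :=
      congrArg Subtype.val (congr_toLin (congrArg (fun η => NatTrans.app η (regular k C)) h)
        (coactCotensor M m))
    have h2 := congrArg (counitL C N) h1
    rwa [evalL_lTensor, evalL_lTensor, counitL_ρl] at h2

end FullyFaithful

/-! ### Lax module structures on a cotensor functor and `H`-actions. -/

section Lax

variable {k : Type u} [Field k] {H : Type u} [Ring H] [Bialgebra k H]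
variable {C : Type u} [AddCommGroup C] [Module k C] [Coalgebra k C]
  [Module H C] [IsScalarTower k H C]
variable {D : Type u} [AddCommGroup D] [Module k D] [Coalgebra k D]
  [Module H D] [IsScalarTower k H D]
variable [IsModuleCoalgebra k H C] [IsModuleCoalgebra k H D]
variable {M : Bicomod k C D}

lemma laxLeftLinear_ext {V A B : Type*} [Category* V] [MonoidalCategory V] [Category* A]
    [Category* B] [MonoidalLeftAction V A] [MonoidalLeftAction V B] {F : A ⥤ B}
    {a b : F.LaxLeftLinear V} (h : ∀ X W, a.μₗ X W = b.μₗ X W) : a = b := by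
  cases a
  cases b
  congr
  funext X W
  exact h X W

/-- The colinear map `H ⊗ M ⟶ M` underlying the operation of a lax module structure. -/
def operationHom (ξ : (cotensorFunctor M).LaxLeftLinear (RightComod k H)) :
    tensorObj (regular k H) M.right ⟶ M.right :=
  tensorMap (𝟙 (regular k H)) (coactHom M) ≫ ξ.μₗ (regular k H) (regular k C) ≫
    evalHom (tensorObj (regular k H) (regular k C)) M
      (LinearMap.mul' k k ∘ₗ TensorProduct.map (Coalgebra.counit (R := k) (A := H))
        (Coalgebra.counit (R := k) (A := C)))

/-- The operation of a lax module structure as a bilinear map. -/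
def operation (ξ : (cotensorFunctor M).LaxLeftLinear (RightComod k H)) : H →ₗ[k] M →ₗ[k] M :=
  TensorProduct.curry (operationHom ξ).toLin

/-- The value of a lax module structure as a linear map to `(X ⊗ W) ⊗ M`. -/
def laxLin (ξ : (cotensorFunctor M).LaxLeftLinear (RightComod k H)) (X : RightComod k H)
    (W : RightComod k C) : X ⊗[k] cotensor W M →ₗ[k] (X ⊗[k] W) ⊗[k] M :=
  (cotensor (tensorObj X W) M).subtype ∘ₗ (ξ.μₗ X W).toLin

lemma laxLin_natural_left (ξ : (cotensorFunctor M).LaxLeftLinear (RightComod k H))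
    {X X' : RightComod k H} (f : X ⟶ X') (W : RightComod k C) (x : X) (t : cotensor W M) :
    laxLin ξ X' W (f.toLin x ⊗ₜ t) = (f.toLin.rTensor W).rTensor M (laxLin ξ X W (x ⊗ₜ t)) :=
  congrArg Subtype.val (congr_toLin (ξ.μₗ_naturality_left f W) (x ⊗ₜ t))

lemma laxLin_natural_right (ξ : (cotensorFunctor M).LaxLeftLinear (RightComod k H))
    (X : RightComod k H) {W W' : RightComod k C} (f : W ⟶ W') (x : X) (t : cotensor W M) :
    laxLin ξ X W' (x ⊗ₜ (cotensorHom f (𝟙 M)).toLin t) =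
      (f.toLin.lTensor X).rTensor M (laxLin ξ X W (x ⊗ₜ t)) :=
  congrArg Subtype.val (congr_toLin (ξ.μₗ_naturality_right X f) (x ⊗ₜ t))

lemma evalL_mul' {A B V : Type u} [AddCommGroup A] [Module k A] [AddCommGroup B] [Module k B]
    [AddCommGroup V] [Module k V] (α : A →ₗ[k] k) (β : B →ₗ[k] k) (z : (A ⊗[k] B) ⊗[k] V) :
    evalL V β ((evalL B α).rTensor V z) =
      evalL V (LinearMap.mul' k k ∘ₗ TensorProduct.map α β) z := by
  have : evalL V β ∘ₗ (evalL B α).rTensor V =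
      evalL V (LinearMap.mul' k k ∘ₗ TensorProduct.map α β) :=
    TensorProduct.ext_threefold fun a b v => by simp [mul_smul]
  exact LinearMap.congr_fun this z

/-- For fixed `h`, applying `ε` to the factor `H` leaves a family `W □ M → W ⊗ M` natural in `W`. It
is thus determined by a map `M → M`, which is the operation of `h`. -/
lemma evalL_laxLin (ξ : (cotensorFunctor M).LaxLeftLinear (RightComod k H)) (W : RightComod k C)
    (h : H) (t : cotensor W M) :
    (evalL W (Coalgebra.counit (R := k) (A := H))).rTensor M
      (laxLin ξ (regular k H) W (h ⊗ₜ t)) = (operation ξ h).lTensor W t.1 := by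
  have key := natural_cotensor_formula
    (fun W => (evalL W (Coalgebra.counit (R := k) (A := H))).rTensor M ∘ₗ
      laxLin ξ (regular k H) W ∘ₗ TensorProduct.mk k H (cotensor W M) h)
    (fun {W W'} f t => by
      have h1 := laxLin_natural_right ξ (regular k H) f h t
      refine (congrArg ((evalL W' (Coalgebra.counit (R := k) (A := H))).rTensor M) h1).trans ?_
      rw [LinearMap.comp_apply, ← LinearMap.rTensor_comp_apply, ← LinearMap.rTensor_comp_apply]
      congr 2
      exact LinearMap.ext fun z => evalL_lTensor _ f.toLin z) W t
  refine key.trans ?_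
  congr 2
  exact LinearMap.ext fun m => evalL_mul' _ _ _

/-- A lax module structure is given by the formula `x ⊗ (w ⊗ m) ↦ (x₀ ⊗ w) ⊗ x₁m`. -/
lemma laxLin_tmul (ξ : (cotensorFunctor M).LaxLeftLinear (RightComod k H)) (X : RightComod k H)
    (W : RightComod k C) (x : X) (t : cotensor W M) :
    laxLin ξ X W (x ⊗ₜ t) =
      TensorProduct.map₂ (TensorProduct.mk k X W) (operation ξ) (X.ρ x) t.1 := by
  apply (TensorProduct.assoc k X W M).injective
  -- For fixed `t` the family `x ↦ ξ(x ⊗ t)` is natural in `X`, so it is governed by its value at `X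
  -- = H`, which `evalL_laxLin` computes.
  have key := natural_coaction_formula
    (fun X : RightComod k H => (TensorProduct.assoc k X W M).toLinearMap ∘ₗ
      laxLin ξ X W ∘ₗ (TensorProduct.mk k X (cotensor W M)).flip t)
    (fun {X X'} f x => by
      refine (congrArg (TensorProduct.assoc k X' W M) (laxLin_natural_left ξ f W x t)).trans ?_
      exact assoc_rTensor_rTensor _ _) X x
  refine key.trans ?_
  have h1 : counitL H (W ⊗[k] M) ∘ₗ (TensorProduct.assoc k H W M).toLinearMap ∘ₗ
      laxLin ξ (regular k H) W ∘ₗ (TensorProduct.mk k H (cotensor W M)).flip t =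
      (LinearMap.lTensorHom W ∘ₗ operation ξ).flip t.1 :=
    LinearMap.ext fun h => (evalL_assoc _ _).trans (evalL_laxLin ξ W h t)
  refine (congrArg (fun f => LinearMap.lTensor X.carrier f (X.ρ x)) h1).trans ?_
  generalize X.ρ x = a
  generalize t.1 = b
  induction a with
  | zero => simp
  | add a a' ha ha' => simp only [map_add, LinearMap.add_apply, ha, ha']
  | tmul x z =>
    induction b with
    | zero => simp
    | add b b' hb hb' => simp only [map_add, LinearMap.lTensor_add, LinearMap.add_apply, hb, hb']
    | tmul y p => simp

/-- The unit comodule has coaction `1 ↦ 1 ⊗ 1`, so unitality at `W = C`, evaluated on `1 ⊗ ρˡ(m)`,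
involves exactly the operation of `1`. -/
lemma operation_one (ξ : (cotensorFunctor M).LaxLeftLinear (RightComod k H)) :
    operation ξ 1 = 1 := by
  refine LinearMap.ext fun m => ?_
  have h := congrArg Subtype.val (congr_toLin (ξ.μₗ_unitality (regular k C))
    ((1 : k) ⊗ₜ coactCotensor M m))
  have h1 : (1 : k) • M.ρl m = (TensorProduct.lid k C).toLinearMap.rTensor M
      (laxLin ξ (unitObj k H) (regular k C) ((1 : k) ⊗ₜ coactCotensor M m)) := h
  have h2 : (unitObj k H).ρ (1 : k) = (1 : k) ⊗ₜ[k] (1 : H) := rfl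
  rw [laxLin_tmul, h2, one_smul] at h1
  have h3 : ∀ z : C ⊗[k] M, counitL C M ((TensorProduct.lid k C).toLinearMap.rTensor M
      (TensorProduct.map₂ (TensorProduct.mk k k C) (operation ξ) ((1 : k) ⊗ₜ[k] (1 : H)) z)) =
      operation ξ 1 (counitL C M z) := by
    intro z
    induction z with
    | zero => simp
    | add a b ha hb => simp only [map_add, ha, hb]
    | tmul c m => simp
  have h4 := congrArg (counitL C M) h1
  refine Eq.trans ?_ (h4.symm.trans (counitL_ρl M m))
  exact ((h3 (M.ρl m)).trans (congrArg _ (counitL_ρl M m))).symm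

/-- This is associativity of `ξ` at `X = Y = H`, `W = C`, followed by all counits. The product `hh'`
appears because the coaction of `H ⊗ H` multiplies the `H`-components. -/
lemma operation_mul (ξ : (cotensorFunctor M).LaxLeftLinear (RightComod k H)) (h h' : H) :
    operation ξ (h * h') = operation ξ h * operation ξ h' := by
  refine LinearMap.ext fun m => ?_
  have h0 := congrArg Subtype.val (congr_toLin
    (ξ.μₗ_associativity (regular k H) (regular k H) (regular k C))
    ((h ⊗ₜ[k] h') ⊗ₜ[k] coactCotensor M m))
  have h1 : (TensorProduct.assoc k H H C).toLinearMap.rTensor M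
      (laxLin ξ (tensorObj (regular k H) (regular k H)) (regular k C)
        ((h ⊗ₜ[k] h') ⊗ₜ[k] coactCotensor M m)) =
      laxLin ξ (regular k H) (tensorObj (regular k H) (regular k C))
        (h ⊗ₜ[k] (ξ.μₗ (regular k H) (regular k C)).toLin (h' ⊗ₜ[k] coactCotensor M m)) := h0
  have h2 : ((ξ.μₗ (regular k H) (regular k C)).toLin (h' ⊗ₜ[k] coactCotensor M m)).1 =
      TensorProduct.map₂ (TensorProduct.mk k H C) (operation ξ) (Coalgebra.comul (R := k) h')
        (M.ρl m) := laxLin_tmul ξ (regular k H) (regular k C) h' (coactCotensor M m)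
  rw [laxLin_tmul, laxLin_tmul] at h1
  have hε : ∀ (z : H), counitL H H (Coalgebra.comul (R := k) z) = z := fun z => by simp [evalL]
  have h3 := congrArg (evalL M (LinearMap.mul' k k ∘ₗ TensorProduct.map
    (Coalgebra.counit (R := k) (A := H)) (LinearMap.mul' k k ∘ₗ TensorProduct.map
    (Coalgebra.counit (R := k) (A := H)) (Coalgebra.counit (R := k) (A := C))))) h1
  have h4 : ∀ z : ((H ⊗[k] H) ⊗[k] C) ⊗[k] M,
      evalL M (LinearMap.mul' k k ∘ₗ TensorProduct.map
        (Coalgebra.counit (R := k) (A := H)) (LinearMap.mul' k k ∘ₗ TensorProduct.map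
        (Coalgebra.counit (R := k) (A := H)) (Coalgebra.counit (R := k) (A := C))))
        ((TensorProduct.assoc k H H C).toLinearMap.rTensor M z) =
      evalL M (LinearMap.mul' k k ∘ₗ TensorProduct.map (LinearMap.mul' k k ∘ₗ TensorProduct.map
        (Coalgebra.counit (R := k) (A := H)) (Coalgebra.counit (R := k) (A := H)))
        (Coalgebra.counit (R := k) (A := C))) z := by
    intro z
    have : evalL M (LinearMap.mul' k k ∘ₗ TensorProduct.map
        (Coalgebra.counit (R := k) (A := H)) (LinearMap.mul' k k ∘ₗ TensorProduct.map
        (Coalgebra.counit (R := k) (A := H)) (Coalgebra.counit (R := k) (A := C)))) ∘ₗ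
        (TensorProduct.assoc k H H C).toLinearMap.rTensor M =
      evalL M (LinearMap.mul' k k ∘ₗ TensorProduct.map (LinearMap.mul' k k ∘ₗ TensorProduct.map
        (Coalgebra.counit (R := k) (A := H)) (Coalgebra.counit (R := k) (A := H)))
        (Coalgebra.counit (R := k) (A := C))) :=
      TensorProduct.ext_fourfold fun a b c m => by simp [mul_assoc]
    exact LinearMap.congr_fun this z
  refine Eq.trans ?_ (((h4 _).symm.trans h3).trans ?_)
  · refine Eq.trans ?_ (evalL_map₂ _ _ _ _ _).symm
    refine congrArg₂ (fun a b => operation ξ a b) ?_ (counitL_ρl M m).symm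
    refine Eq.trans ?_ (evalL_map₂ _ _ _ _ _).symm
    exact (congrArg₂ (· * ·) (hε h) (hε h')).symm
  · refine (evalL_map₂ _ _ _ _ _).trans ?_
    refine congrArg₂ (fun a b => operation ξ a b) (hε h) ?_
    refine (congrArg _ h2).trans ((evalL_map₂ _ _ _ _ _).trans ?_)
    exact congrArg₂ (fun a b => operation ξ a b) (hε h') (counitL_ρl M m)

/-- The `H`-action determined by a lax module structure on the cotensor functor. -/
def actionOfLax (ξ : (cotensorFunctor M).LaxLeftLinear (RightComod k H)) :
    EquivariantAction H M where
  act := AlgHom.ofLinearMap (operation ξ) (operation_one ξ) (operation_mul ξ)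
  coact_left h m := by
    change M.ρl (operation ξ h m) = TensorProduct.map₂ (smulMap k H C) (operation ξ) _ _
    have hε : counitL H (H ⊗[k] H) ((Coalgebra.comul (R := k)).lTensor H
        (Coalgebra.comul (R := k) h)) = Coalgebra.comul (R := k) h := by
      rw [evalL_lTensor]
      congr 1
      simp [evalL]
    have hm : counitL C (C ⊗[k] M) (M.ρl.lTensor C (M.ρl m)) = M.ρl m := by
      rw [evalL_lTensor, counitL_ρl]
    have h1 := mem_cotensor.1
      ((ξ.μₗ (regular k H) (regular k C)).toLin (h ⊗ₜ[k] coactCotensor M m)).2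
    have h2 : ((ξ.μₗ (regular k H) (regular k C)).toLin (h ⊗ₜ[k] coactCotensor M m)).1 =
        TensorProduct.map₂ (TensorProduct.mk k H C) (operation ξ) (Coalgebra.comul (R := k) h)
        (M.ρl m) := laxLin_tmul ξ (regular k H) (regular k C) h (coactCotensor M m)
    have h3 : TensorProduct.assoc k (H ⊗[k] C) C M
        ((tensorρ (regular k H) (regular k C)).rTensor M
          (TensorProduct.map₂ (TensorProduct.mk k H C) (operation ξ) (Coalgebra.comul (R := k) h)
            (M.ρl m))) =
        TensorProduct.map₂ (TensorProduct.mk k H C)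
          (TensorProduct.map₂ (smulMap k H C) (operation ξ))
          ((Coalgebra.comul (R := k)).lTensor H (Coalgebra.comul (R := k) h))
          (M.ρl.lTensor C (M.ρl m)) := by
      rw [rTensor_map₂ (f₁ := (regular k H).ρ) (f₂ := (regular k C).ρ)
        (fun x y => tensorρ_tmul (regular k H) (regular k C) x y), assoc_map₂, M.coassoc_left]
      congr 2
      exact Coalgebra.coassoc_apply h
    -- `h1` expresses that `ξ(h ⊗ ρˡ(m))` lies in `(H ⊗ C) □ M`. Applying `ε ⊗ ε` to the factor `H ⊗
    -- C` leaves the left coaction condition.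
    have h4 := congrArg (evalL (C ⊗[k] M) (LinearMap.mul' k k ∘ₗ TensorProduct.map
      (Coalgebra.counit (R := k) (A := H)) (Coalgebra.counit (R := k) (A := C))))
      ((h3.symm.trans (congrArg _ (congrArg _ h2.symm))).trans h1)
    refine ((h4.trans (evalL_lTensor _ _ _)).symm).trans ?_
    rw [evalL_map₂]
    exact congrArg₂ (fun a b => TensorProduct.map₂ (smulMap k H C) (operation ξ) a b) hε hm
  coact_right h m := by
    -- The right coaction condition is colinearity of the operation `H ⊗ M ⟶ M`, which is a
    -- composite of colinear maps.
    refine ((operationHom ξ).comm (h ⊗ₜ[k] m)).trans ?_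
    refine (congrArg ((operationHom ξ).toLin.rTensor D)
      (tensorρ_tmul (regular k H) M.right h m)).trans ?_
    refine (rTensor_map₂ (φ' := operation ξ) (f₁ := LinearMap.id) (f₂ := LinearMap.id)
      (fun x y => rfl) _ _).trans ?_
    rw [LinearMap.rTensor_id, LinearMap.rTensor_id]
    rfl

lemma operation_laxOfAction (a : EquivariantAction H M) :
    operation (laxOfAction a) = a.act.toLinearMap := by
  refine LinearMap.ext₂ fun h m => ?_
  refine (evalL_map₂ _ _ _ _ _).trans ?_
  refine congrArg₂ (fun x y => a.act x y) ?_ (counitL_ρl M m)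
  simp [evalL]

/-- Equivariant actions correspond to lax module structures on the cotensor functor. -/
def actionEquivLax : EquivariantAction H M ≃ (cotensorFunctor M).LaxLeftLinear (RightComod k H)
    where
  toFun := laxOfAction
  invFun := actionOfLax
  left_inv a := EquivariantAction.ext
    (AlgHom.toLinearMap_injective (operation_laxOfAction a))
  right_inv ξ := laxLeftLinear_ext fun X W => tensor_cotensor_hom_ext fun x t =>
    (laxLin_tmul ξ X W x t).symm

end Lax

/-! ### The cofree copresentation of a comodule. -/

section Cofree

variable {k : Type u} [Field k] {C : Type u} [AddCommGroup C] [Module k C] [Coalgebra k C]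
variable {U U' : Type u} [AddCommGroup U] [Module k U] [AddCommGroup U'] [Module k U']

/-- A basis of `U` exhibits `U ⊗ X` as a direct sum of copies of `X`. -/
lemma isDirectSum_vecTensor {ι : Type u} (b : Module.Basis ι k U) (X : RightComod k C) :
    IsDirectSum (fun i => insert X (b i)) (fun i => evalVec X (b.coord i)) where
  self i := hom_ext (LinearMap.ext fun x => by
    change b.coord i (b i) • x = x
    simp)
  ne i j hij := hom_ext (LinearMap.ext fun x => by
    change b.coord j (b i) • x = 0
    simp [Finsupp.single_eq_of_ne hij.symm])
  sum := fun (s : U ⊗[k] X) => by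
    classical
    have key : ∀ z : U ⊗[k] X, ∃ A : Finset ι, ∀ B, A ⊆ B →
        ∑ j ∈ B, b j ⊗ₜ[k] evalL X (b.coord j) z = z := by
      intro z
      induction z with
      | zero => exact ⟨∅, by simp⟩
      | add a b ha hb =>
        obtain ⟨A, hA⟩ := ha
        obtain ⟨A', hA'⟩ := hb
        refine ⟨A ∪ A', fun B hB => ?_⟩
        simp only [map_add, TensorProduct.tmul_add, Finset.sum_add_distrib]
        rw [hA B (Finset.union_subset_left hB), hA' B (Finset.union_subset_right hB)]
      | tmul v x =>
        refine ⟨(b.repr v).support, fun B hB => ?_⟩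
        simp only [evalL_tmul, ← TensorProduct.smul_tmul]
        rw [← TensorProduct.sum_tmul]
        congr 1
        conv_rhs => rw [← b.linearCombination_repr v, Finsupp.linearCombination_apply]
        refine (Finset.sum_subset hB fun j _ hj => ?_).symm
        exact (congrArg (· • b j) (Finsupp.notMem_support_iff.1 hj)).trans (zero_smul _ _)
    obtain ⟨A, hA⟩ := key s
    exact ⟨A, hA A subset_rfl⟩

/-- The associativity `U ⊗ (U' ⊗ X) ⟶ (U ⊗ U') ⊗ X`. -/
def vecAssoc (U U' : Type u) [AddCommGroup U] [Module k U] [AddCommGroup U'] [Module k U']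
    (X : RightComod k C) : vecTensor U (vecTensor U' X) ⟶ vecTensor (U ⊗[k] U') X where
  toLin := (TensorProduct.assoc k U U' X).symm.toLinearMap
  comm t := by
    have : (vecTensor (U ⊗[k] U') X).ρ ∘ₗ (TensorProduct.assoc k U U' X).symm.toLinearMap =
        (TensorProduct.assoc k U U' X).symm.toLinearMap.rTensor C ∘ₗ
          (vecTensor U (vecTensor U' X)).ρ := by
      refine TensorProduct.ext (LinearMap.ext fun v => TensorProduct.ext' fun v' x => ?_)
      refine (vecTensor_ρ_tmul X (v ⊗ₜ[k] v') x).trans (Eq.trans ?_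
        (congrArg ((TensorProduct.assoc k U U' X).symm.toLinearMap.rTensor C)
          ((vecTensor_ρ_tmul (vecTensor U' X) v (v' ⊗ₜ[k] x)).trans
            (congrArg ((TensorProduct.mk k U (U' ⊗[k] X) v).rTensor C)
              (vecTensor_ρ_tmul X v' x)))).symm)
      rw [← LinearMap.rTensor_comp_apply, ← LinearMap.rTensor_comp_apply]
      congr 2
    exact LinearMap.congr_fun this t

/-- The two maps `W ⊗ C ⟶ (W ⊗ C) ⊗ C` have difference `ρ ⊗ id - id ⊗ Δ`. -/
def cofreeDiff (W : RightComod k C) :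
    vecTensor W (regular k C) ⟶ vecTensor (W ⊗[k] C) (regular k C) :=
  vecMap W.ρ (𝟙 _) -
    vecMap LinearMap.id (coactionHom (regular k C)) ≫ vecAssoc W C (regular k C)

lemma cofreeDiff_apply (W : RightComod k C) (z : W ⊗[k] C) :
    (cofreeDiff W).toLin z = W.ρ.rTensor C z -
      (TensorProduct.assoc k W C C).symm ((Coalgebra.comul (R := k)).lTensor W z) := rfl

lemma coactionHom_comp_cofreeDiff (W : RightComod k C) : coactionHom W ≫ cofreeDiff W = 0 := by
  refine hom_ext (LinearMap.ext fun w => ?_)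
  refine (cofreeDiff_apply W (W.ρ w)).trans (sub_eq_zero.2 ?_)
  apply (TensorProduct.assoc k W C C).injective
  exact (W.coassoc w).trans (LinearEquiv.apply_symm_apply _ _).symm

lemma coactionHom_injective (W : RightComod k C) : Function.Injective (coactionHom W).toLin :=
  fun x y hxy => (W.counit x).symm.trans ((congrArg (fun z => TensorProduct.rid k W
    ((Coalgebra.counit (R := k) (A := C)).lTensor W z)) hxy).trans (W.counit y))

/-- The counit splits the copresentation: applying `ε` to the last factor of `(ρ ⊗ id)z = (id ⊗ Δ)z`
gives `ρ((id ⊗ ε)z) = z`. -/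
lemma mem_range_coactionHom (W : RightComod k C) (z : W ⊗[k] C)
    (hz : (cofreeDiff W).toLin z = 0) : z ∈ LinearMap.range (coactionHom W).toLin := by
  refine ⟨TensorProduct.rid k W ((Coalgebra.counit (R := k) (A := C)).lTensor W z), ?_⟩
  have h : W.ρ.rTensor C z = (TensorProduct.assoc k W C C).symm
      ((Coalgebra.comul (R := k)).lTensor W z) :=
    sub_eq_zero.1 ((cofreeDiff_apply W z).symm.trans hz)
  have h1 : TensorProduct.rid k (W ⊗[k] C) ((Coalgebra.counit (R := k) (A := C)).lTensor
      (W ⊗[k] C) ((TensorProduct.assoc k W C C).symm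
      ((Coalgebra.comul (R := k)).lTensor W z))) = z := (vecTensor W (regular k C)).counit z
  rw [← h, lTensor_rTensor_comm, rid_rTensor] at h1
  exact h1

/-- The cofree copresentation of a comodule. -/
def isLimitCoactionHom (W : RightComod k C) :
    IsLimit (KernelFork.ofι (coactionHom W) (coactionHom_comp_cofreeDiff W)) :=
  isLimitKernelFork _ _ _ (coactionHom_injective W) (mem_range_coactionHom W)

end Cofree

/-! ### Reconstruction of a functor of type `𝓛` from its value at `C`. -/

section Theta

variable {k : Type u} [Field k]
variable {C : Type u} [AddCommGroup C] [Module k C] [Coalgebra k C]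
variable {D : Type u} [AddCommGroup D] [Module k D] [Coalgebra k D]
variable (F : RightComod k C ⥤ RightComod k D) [F.Additive] [F.Linear k]
variable (U : Type u) {U' : Type u} [AddCommGroup U] [Module k U] [AddCommGroup U'] [Module k U']

/-- The map `U ⊗ F(X) → F(U ⊗ X)` as a linear map. -/
def thetaLin (X : RightComod k C) : U ⊗[k] F.obj X →ₗ[k] F.obj (vecTensor U X) :=
  TensorProduct.lift
    { toFun v := (F.map (insert X v)).toLin
      map_add' v v' := by
        have : insert X (v + v') = insert X v + insert X v' :=
          hom_ext (map_add (TensorProduct.mk k U X) v v')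
        rw [this, F.map_add, add_toLin]
      map_smul' c v := by
        have : insert X (c • v) = c • insert X v :=
          hom_ext (map_smul (TensorProduct.mk k U X) c v)
        rw [this, F.map_smul, smul_toLin, RingHom.id_apply] }

/-- The colinear map `U ⊗ F(X) ⟶ F(U ⊗ X)`. -/
def theta (X : RightComod k C) : vecTensor U (F.obj X) ⟶ F.obj (vecTensor U X) where
  toLin := thetaLin F U X
  comm t := by
    have : (F.obj (vecTensor U X)).ρ ∘ₗ thetaLin F U X =
        (thetaLin F U X).rTensor D ∘ₗ (vecTensor U (F.obj X)).ρ :=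
      TensorProduct.ext' fun v x => by
        refine ((F.map (insert X v)).comm x).trans (Eq.trans ?_
          (congrArg ((thetaLin F U X).rTensor D) (vecTensor_ρ_tmul (F.obj X) v x)).symm)
        rw [← LinearMap.rTensor_comp_apply]
        rfl
    exact LinearMap.congr_fun this t

variable {U}

lemma theta_natural (X : RightComod k C) (f : U →ₗ[k] U') (y : U ⊗[k] F.obj X) :
    (theta F U' X).toLin (f.rTensor (F.obj X) y) =
      (F.map (vecMap f (𝟙 X))).toLin ((theta F U X).toLin y) := by
  have : (theta F U' X).toLin ∘ₗ f.rTensor (F.obj X) =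
      (F.map (vecMap f (𝟙 X))).toLin ∘ₗ (theta F U X).toLin := by
    refine TensorProduct.ext' fun v x => ?_
    have h : insert X (f v) = insert X v ≫ vecMap f (𝟙 X) := rfl
    have h' := congr_toLin (congrArg F.map h) x
    rw [F.map_comp] at h'
    exact h'
  exact LinearMap.congr_fun this y

/-- Inserting `v` and then evaluating `α` is multiplication by `α(v)`, which the linear functor `F`
preserves. This supplies the left counit axiom of `F(C)`. -/
lemma theta_evalVec (X : RightComod k C) (α : U →ₗ[k] k) (y : U ⊗[k] F.obj X) :
    (F.map (evalVec X α)).toLin ((theta F U X).toLin y) = evalL (F.obj X) α y := by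
  have : (F.map (evalVec X α)).toLin ∘ₗ (theta F U X).toLin = evalL (F.obj X) α := by
    refine TensorProduct.ext' fun v x => ?_
    have h : insert X v ≫ evalVec X α = α v • 𝟙 X := rfl
    have h' := congr_toLin (congrArg F.map h) x
    rw [F.map_comp, F.map_smul, CategoryTheory.Functor.map_id] at h'
    exact h'
  exact LinearMap.congr_fun this y

/-- A basis of `U` presents both sides as coproducts of copies of `F(X)`, the target because `F`
preserves coproducts. The map `theta` matches the inclusions, so it is the comparison isomorphism.
-/
lemma isIso_theta [∀ J : Type u, PreservesColimitsOfShape (Discrete J) F] (X : RightComod k C) :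
    IsIso (theta F U X) := by
  let b := Module.Basis.ofVectorSpace k U
  let h1 := (isDirectSum_vecTensor b (F.obj X)).isColimit
  let h2 := isColimitCofanMkObjOfIsColimit F _ _ (isDirectSum_vecTensor b X).isColimit
  have h3 : theta F U X = (h1.coconePointUniqueUpToIso h2).hom :=
    h1.hom_ext fun ⟨i⟩ => (h1.comp_coconePointUniqueUpToIso_hom h2 ⟨i⟩).symm
  rw [h3]
  infer_instance

variable [∀ J : Type u, PreservesColimitsOfShape (Discrete J) F]

/-- The map `F(W) ⟶ W ⊗ F(C)` obtained from the coaction of `W`. -/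
def phi (W : RightComod k C) : F.obj W ⟶ vecTensor W (F.obj (regular k C)) :=
  have := isIso_theta F (U := W) (regular k C)
  F.map (coactionHom W) ≫ inv (theta F W (regular k C))

lemma phi_comp_theta (W : RightComod k C) :
    phi F W ≫ theta F W (regular k C) = F.map (coactionHom W) := by
  have := isIso_theta F (U := W) (regular k C)
  rw [phi, Category.assoc, IsIso.inv_hom_id, Category.comp_id]

lemma theta_phi (W : RightComod k C) (x : F.obj W) :
    (theta F W (regular k C)).toLin ((phi F W).toLin x) = (F.map (coactionHom W)).toLin x :=
  congr_toLin (phi_comp_theta F W) x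

lemma theta_injective (X : RightComod k C) :
    Function.Injective (theta F U X).toLin :=
  have := isIso_theta F (U := U) X
  (bijective_of_isIso _).1

lemma phi_natural {W W' : RightComod k C} (f : W ⟶ W') :
    F.map f ≫ phi F W' = phi F W ≫ vecMap f.toLin (𝟙 _) := by
  refine hom_ext (LinearMap.ext fun x => theta_injective F (regular k C) ?_)
  refine (theta_phi F W' _).trans (Eq.trans ?_ (theta_natural F _ f.toLin _).symm)
  rw [theta_phi]
  have h : f ≫ coactionHom W' = coactionHom W ≫ vecMap f.toLin (𝟙 _) :=
    hom_ext (LinearMap.ext f.comm)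
  have h' := congr_toLin (congrArg F.map h) x
  rw [F.map_comp, F.map_comp] at h'
  exact h'

/-- Under `theta`, the map `id ⊗ ρˡ` of the future bicomodule `F(C)` corresponds to `F(id ⊗ Δ)`; it
is checked on pure tensors by inserting `w`. -/
lemma theta_assoc_phi (W : RightComod k C) (y : W ⊗[k] F.obj (regular k C)) :
    (theta F (W ⊗[k] C) (regular k C)).toLin ((TensorProduct.assoc k W C _).symm
      ((phi F (regular k C)).toLin.lTensor W y)) =
    (F.map (vecMap LinearMap.id (coactionHom (regular k C)) ≫
      vecAssoc W C (regular k C))).toLin ((theta F W (regular k C)).toLin y) := by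
  have : (theta F (W ⊗[k] C) (regular k C)).toLin ∘ₗ
      (TensorProduct.assoc k W C (F.obj (regular k C))).symm.toLinearMap ∘ₗ
        (phi F (regular k C)).toLin.lTensor W =
      (F.map (vecMap LinearMap.id (coactionHom (regular k C)) ≫
        vecAssoc W C (regular k C))).toLin ∘ₗ (theta F W (regular k C)).toLin := by
    refine TensorProduct.ext' fun w m => ?_
    have hmk : ∀ (P : Type u) [AddCommGroup P] [Module k P] (z : C ⊗[k] P),
        (TensorProduct.assoc k W C P).symm (w ⊗ₜ z) = (TensorProduct.mk k W C w).rTensor P z := by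
      intro P _ _ z
      have : (TensorProduct.assoc k W C P).symm.toLinearMap ∘ₗ
          TensorProduct.mk k W (C ⊗[k] P) w = (TensorProduct.mk k W C w).rTensor P :=
        TensorProduct.ext' fun c v => by simp
      exact LinearMap.congr_fun this z
    refine (congrArg _ (hmk _ _)).trans ((theta_natural F _ _ _).trans ?_)
    refine (congrArg _ (theta_phi F (regular k C) m)).trans ?_
    have h : coactionHom (regular k C) ≫ vecMap (TensorProduct.mk k W C w) (𝟙 _) =
        insert (regular k C) w ≫ vecMap LinearMap.id (coactionHom (regular k C)) ≫
          vecAssoc W C (regular k C) :=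
      hom_ext (LinearMap.ext fun c => (hmk C (Coalgebra.comul (R := k) c)).symm)
    have h' := congr_toLin (congrArg F.map h) m
    rw [F.map_comp, F.map_comp] at h'
    exact h'
  exact LinearMap.congr_fun this y

lemma theta_sub (W : RightComod k C) (y : W ⊗[k] F.obj (regular k C)) :
    (theta F (W ⊗[k] C) (regular k C)).toLin (W.ρ.rTensor (F.obj (regular k C)) y -
      (TensorProduct.assoc k W C (F.obj (regular k C))).symm
        ((phi F (regular k C)).toLin.lTensor W y)) =
    (F.map (cofreeDiff W)).toLin ((theta F W (regular k C)).toLin y) := by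
  rw [cofreeDiff, F.map_sub, sub_toLin, LinearMap.sub_apply]
  exact (map_sub _ _ _).trans
    (congrArg₂ (· - ·) (theta_natural F _ W.ρ y) (theta_assoc_phi F W y))

section Exact

variable [PreservesFiniteLimits F]

lemma phi_exact (W : RightComod k C) :
    Function.Injective (F.map (coactionHom W)).toLin ∧
    ∀ x, (F.map (cofreeDiff W)).toLin x = 0 →
      x ∈ LinearMap.range (F.map (coactionHom W)).toLin :=
  injective_of_isLimit (isLimitForkMapOfIsLimit' F _ (isLimitCoactionHom W))

lemma phi_injective (W : RightComod k C) : Function.Injective (phi F W).toLin := fun x y hxy =>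
  (phi_exact F W).1 ((theta_phi F W x).symm.trans
    ((congrArg (theta F W (regular k C)).toLin hxy).trans (theta_phi F W y)))

/-- By `theta_sub` the cotensor equation says that `theta y` is killed by `F(cofreeDiff W)`, and
left exactness puts such elements in the image of `F` of the coaction. The equation is written out
because `F(C)` is not yet known to be a bicomodule. -/
lemma mem_range_phi (W : RightComod k C) (y : W ⊗[k] F.obj (regular k C)) :
    TensorProduct.assoc k W C (F.obj (regular k C)) (W.ρ.rTensor (F.obj (regular k C)) y) =
      (phi F (regular k C)).toLin.lTensor W y ↔ y ∈ LinearMap.range (phi F W).toLin := by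
  rw [← LinearEquiv.eq_symm_apply, ← sub_eq_zero,
    ← (theta_injective F (U := W ⊗[k] C) (regular k C)).eq_iff, theta_sub, map_zero]
  constructor
  · intro h
    obtain ⟨x, hx⟩ := (phi_exact F W).2 _ h
    exact ⟨x, theta_injective F _ ((theta_phi F W x).trans hx)⟩
  · rintro ⟨x, rfl⟩
    rw [theta_phi]
    have h := congr_toLin (congrArg F.map (coactionHom_comp_cofreeDiff W)) x
    rw [F.map_comp, F.map_zero] at h
    exact h

/-- The bicomodule `F(C)` of a functor `F` of type `𝓛`. -/
abbrev bicomodOfFunctor : Bicomod k C D where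
  carrier := F.obj (regular k C)
  ρl := (phi F (regular k C)).toLin
  ρr := (F.obj (regular k C)).ρ
  -- Coassociativity is the cotensor equation at `W = C` for an element of the image of `phi`.
  coassoc_left m := (mem_range_phi F (regular k C) _).2 ⟨m, rfl⟩
  counit_left m := by
    refine (theta_evalVec F (regular k C) Coalgebra.counit
      ((phi F (regular k C)).toLin m)).symm.trans ?_
    rw [theta_phi]
    have h : coactionHom (regular k C) ≫ evalVec (regular k C) Coalgebra.counit = 𝟙 _ :=
      hom_ext (LinearMap.ext fun c => by
        change evalL C Coalgebra.counit (Coalgebra.comul (R := k) c) = c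
        simp [evalL])
    have h' := congr_toLin (congrArg F.map h) m
    rw [F.map_comp, CategoryTheory.Functor.map_id] at h'
    exact h'
  coassoc_right := (F.obj (regular k C)).coassoc
  counit_right := (F.obj (regular k C)).counit
  compat m := by
    rw [← LinearEquiv.eq_symm_apply]
    exact ((phi F (regular k C)).comm m).symm

/-- The comparison map `F(W) ⟶ W □_C F(C)`. -/
def toCotensor (W : RightComod k C) : F.obj W ⟶ cotensorObj W (bicomodOfFunctor F) :=
  liftOfInjective (subι (freeTensor W (bicomodOfFunctor F)) (cotensor W (bicomodOfFunctor F))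
    (cotensor_coaction W (bicomodOfFunctor F))) Subtype.val_injective (phi F W)
    fun x => ⟨⟨(phi F W).toLin x, mem_cotensor.2 ((mem_range_phi F W _).2 ⟨x, rfl⟩)⟩, rfl⟩

lemma toCotensor_coe (W : RightComod k C) (x : F.obj W) :
    ((toCotensor F W).toLin x : cotensor W (bicomodOfFunctor F)).1 = (phi F W).toLin x :=
  congr_toLin (liftOfInjective_comp (subι (freeTensor W (bicomodOfFunctor F))
    (cotensor W (bicomodOfFunctor F)) (cotensor_coaction W (bicomodOfFunctor F)))
    Subtype.val_injective (phi F W) _) x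

lemma toCotensor_bijective (W : RightComod k C) : Function.Bijective (toCotensor F W).toLin := by
  refine ⟨fun x y hxy => phi_injective F W ?_,
    fun (t : cotensor W (bicomodOfFunctor F)) => ?_⟩
  · exact (toCotensor_coe F W x).symm.trans
      ((congrArg Subtype.val hxy).trans (toCotensor_coe F W y))
  · have ht := (mem_cotensor (W := W) (M := bicomodOfFunctor F)).1 t.2
    obtain ⟨x, hx⟩ := (mem_range_phi F W t.1).1 ht
    have h : ((toCotensor F W).toLin x : cotensor W (bicomodOfFunctor F)) = t :=
      Subtype.ext ((toCotensor_coe F W x).trans hx)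
    exact ⟨x, h⟩

lemma toCotensor_natural {W W' : RightComod k C} (f : W ⟶ W') :
    F.map f ≫ toCotensor F W' =
      toCotensor F W ≫ (cotensorFunctor (bicomodOfFunctor F)).map f := by
  refine cotensor_hom_ext fun x => ?_
  have h1 := toCotensor_coe F W' ((F.map f).toLin x)
  have h2 : (phi F W').toLin ((F.map f).toLin x) =
      TensorProduct.map f.toLin LinearMap.id ((phi F W).toLin x) :=
    congr_toLin (phi_natural F f) x
  refine (h1.trans h2).trans ?_
  rw [← toCotensor_coe]
  rfl

/-- A functor of type `𝓛` is isomorphic to a cotensor functor. -/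
def isoCotensorFunctor : F ≅ cotensorFunctor (bicomodOfFunctor F) :=
  NatIso.ofComponents (fun W => isoOfBijective (toCotensor F W) (toCotensor_bijective F W))
    fun f => toCotensor_natural F f

end Exact

end Theta

/-! ### Transport of lax structures along isomorphisms of functors. -/

section Transport

variable {V A B : Type*} [Category* V] [MonoidalCategory V] [Category* A]
    [Category* B] [MonoidalLeftAction V A] [MonoidalLeftAction V B]

/-- Transport of a lax module structure along an isomorphism of functors. -/
abbrev laxTransport {F G : A ⥤ B} (ξ : F.LaxLeftLinear V) (α : F ≅ G) : G.LaxLeftLinear V where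
  μₗ X W := X ⊴ₗ α.inv.app W ≫ ξ.μₗ X W ≫ α.hom.app (X ⊙ₗ W)
  μₗ_naturality_left {X X'} f W := by
    rw [← action_exchange_assoc, ξ.μₗ_naturality_left_assoc]
    simp
  μₗ_naturality_right X {W W'} f := by
    rw [← actionHomRight_comp_assoc, α.inv.naturality, actionHomRight_comp_assoc,
      ξ.μₗ_naturality_right_assoc]
    simp
  μₗ_associativity X Y W := by
    simp only [Category.assoc, actionHomRight_comp]
    rw [← α.hom.naturality, ξ.μₗ_associativity_assoc, ← actionHomRight_comp_assoc _ (α.hom.app _),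
      α.hom_inv_id_app, actionHomRight_id, Category.id_comp]
    simp
  μₗ_unitality W := by
    simp only [Category.assoc]
    rw [← α.hom.naturality, ← ξ.μₗ_unitality_assoc, ← actionUnitIso_hom_naturality_assoc]
    simp

/-- The isomorphism of lax module functors given by transport of structure. -/
def laxTransportIso {F G : A ⥤ B} (ξ : F.LaxLeftLinear V) (α : F ≅ G) :
    (⟨F, ξ⟩ : LaxModuleFunctor V A B) ≅ ⟨G, laxTransport ξ α⟩ where
  hom := ⟨α.hom, fun X W => by
    change _ = _ ≫ X ⊴ₗ α.inv.app W ≫ ξ.μₗ X W ≫ α.hom.app (X ⊙ₗ W)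
    rw [← actionHomRight_comp_assoc, α.hom_inv_id_app, actionHomRight_id, Category.id_comp]⟩
  inv := ⟨α.inv, fun X W => by
    change (X ⊴ₗ α.inv.app W ≫ ξ.μₗ X W ≫ α.hom.app (X ⊙ₗ W)) ≫ _ = _
    rw [Category.assoc, Category.assoc, α.hom_inv_id_app, Category.comp_id]⟩
  hom_inv_id := LaxModuleFunctor.Hom.ext α.hom_inv_id
  inv_hom_id := LaxModuleFunctor.Hom.ext α.inv_hom_id

end Transport

/-! ### The two equivalences. -/

section Equivalence

variable {k : Type u} [Field k] {H : Type u} [Ring H] [Bialgebra k H]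
variable {C : Type u} [AddCommGroup C] [Module k C] [Coalgebra k C]
variable {D : Type u} [AddCommGroup D] [Module k D] [Coalgebra k D]

lemma exists_iso_cotensorFunctor {F : RightComod k C ⥤ RightComod k D} (hF : IsTypeL F) :
    ∃ M : Bicomod k C D, Nonempty (F ≅ cotensorFunctor M) := by
  have := hF.additive
  have := hF.linear
  have := hF.leftExact
  have := hF.coproducts
  exact ⟨bicomodOfFunctor F, ⟨isoCotensorFunctor F⟩⟩

lemma takeuchi_isEquivalence (hT : ∀ M : Bicomod k C D, IsTypeL ((takeuchiFunctor k C D).obj M)) :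
    (ObjectProperty.lift (fun F : RightComod k C ⥤ RightComod k D => IsTypeL F)
        (takeuchiFunctor k C D) hT).IsEquivalence where
  essSurj := ⟨fun F => by
    obtain ⟨M, ⟨α⟩⟩ := exists_iso_cotensorFunctor F.property
    exact ⟨M, ⟨ObjectProperty.isoMk _ α.symm⟩⟩⟩

variable [Module H C] [IsScalarTower k H C] [Module H D] [IsScalarTower k H D]
variable [IsModuleCoalgebra k H C] [IsModuleCoalgebra k H D]

instance : (equivariantTakeuchiFunctor k H C D).Faithful where
  map_injective h := EquivBicomod.Hom.ext
    ((takeuchiFunctor k C D).map_injective (congrArg LaxModuleFunctor.Hom.nat h))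

/-- The underlying transformation already comes from a bicomodule map. Its compatibility with the
lax structures at `(H, C)`, followed by the counits, is `H`-linearity of that map. -/
instance : (equivariantTakeuchiFunctor k H C D).Full where
  map_surjective {M N} f := by
    have key : ∀ (h : H) (m : M.toBicomod),
        (bicomodHomOfNatTrans f.nat).toLin (M.action.act h m) =
          N.action.act h ((bicomodHomOfNatTrans f.nat).toLin m) := by
      intro h m
      have hε : counitL H H (Coalgebra.comul (R := k) h) = h := by simp [evalL]
      have h1 := congrArg Subtype.val (congr_toLin (f.comm (regular k H) (regular k C))
        (h ⊗ₜ[k] coactCotensor M.toBicomod m))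
      have h2 := (natTrans_apply f.nat (tensorObj (regular k H) (regular k C))
        ((laxHom M.action (regular k H) (regular k C)).toLin
          (h ⊗ₜ[k] coactCotensor M.toBicomod m))).symm.trans h1
      have h3 := congrArg (evalL N.toBicomod (LinearMap.mul' k k ∘ₗ TensorProduct.map
        (Coalgebra.counit (R := k) (A := H)) (Coalgebra.counit (R := k) (A := C)))) h2
      refine Eq.trans ?_ (h3.trans ?_)
      · refine Eq.trans ?_ (evalL_lTensor _ _ _).symm
        refine congrArg _ ((evalL_map₂ _ _ _ _ _).trans ?_).symm
        exact congrArg₂ (fun a b => M.action.act a b) hε (counitL_ρl M.toBicomod m)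
      · refine (evalL_map₂ _ _ _ _ _).trans ?_
        refine congrArg₂ (fun a b => N.action.act a b) hε ?_
        refine (congrArg _ (natTrans_apply f.nat (regular k C)
          (coactCotensor M.toBicomod m))).trans ((evalL_lTensor _ _ _).trans ?_)
        exact congrArg _ (counitL_ρl M.toBicomod m)
    refine ⟨⟨bicomodHomOfNatTrans f.nat, key⟩, LaxModuleFunctor.Hom.ext ?_⟩
    exact NatTrans.ext <| funext fun W => cotensor_hom_ext fun (t : cotensor W M.toBicomod) =>
      (natTrans_apply f.nat W t).symm

lemma equivariantTakeuchi_isEquivalence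
    (hT : ∀ M : EquivBicomod k H C D,
      IsTypeL ((equivariantTakeuchiFunctor k H C D).obj M).functor) :
    (ObjectProperty.lift
        (fun F : LaxModuleFunctor (RightComod k H) (RightComod k C) (RightComod k D) =>
          IsTypeL F.functor) (equivariantTakeuchiFunctor k H C D) hT).IsEquivalence where
  essSurj := ⟨fun F => by
    obtain ⟨M, ⟨α⟩⟩ := exists_iso_cotensorFunctor F.property
    let ξ := laxTransport F.obj.lax α
    have h : laxOfAction (actionOfLax ξ) = ξ := actionEquivLax.right_inv ξ
    have e : (equivariantTakeuchiFunctor k H C D).obj ⟨M, actionOfLax ξ⟩ ≅ F.obj :=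
      -- The transported structure equals the one coming from its action, by part (a); the
      -- underlying functor is the same on both sides.
      eqToIso (congrArg (LaxModuleFunctor.mk (cotensorFunctor M)) h) ≪≫
        (laxTransportIso F.obj.lax α).symm
    exact ⟨⟨M, actionOfLax ξ⟩, ⟨ObjectProperty.isoMk _ e⟩⟩⟩

end Equivalence

end EquivEW

end

theorem mainTheorem1 (k : Type u) [Field k] (H : Type u) [Ring H] [Bialgebra k H]
    (C : Type u) [AddCommGroup C] [Module k C] [Coalgebra k C]
    [Module H C] [IsScalarTower k H C] [IsModuleCoalgebra k H C]
    (D : Type u) [AddCommGroup D] [Module k D] [Coalgebra k D]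
    [Module H D] [IsScalarTower k H D] [IsModuleCoalgebra k H D] :
    (∀ M : Bicomod k C D,
      ∃ e : EquivariantAction H M ≃ (cotensorFunctor M).LaxLeftLinear (RightComod k H),
        (∀ a : EquivariantAction H M, e a = laxOfAction a) ∧
        (∀ (ξ : (cotensorFunctor M).LaxLeftLinear (RightComod k H)) (h : H) (m : M),
          (e.symm ξ).act h m = operationOfLax ξ h m)) ∧
    equivariantTakeuchiFunctor k H C D ⋙
        LaxModuleFunctor.forget (RightComod k H) (RightComod k C) (RightComod k D) =
      EquivBicomod.forget k H C D ⋙ takeuchiFunctor k C D ∧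
    ∃ hT : ∀ M : Bicomod k C D, IsTypeL ((takeuchiFunctor k C D).obj M),
      (ObjectProperty.lift (fun F : RightComod k C ⥤ RightComod k D => IsTypeL F)
        (takeuchiFunctor k C D) hT).IsEquivalence ∧
      (ObjectProperty.lift
        (fun F : LaxModuleFunctor (RightComod k H) (RightComod k C) (RightComod k D) =>
          IsTypeL F.functor)
        (equivariantTakeuchiFunctor k H C D) (fun M => hT M.toBicomod)).IsEquivalence :=
  ⟨fun _ => ⟨actionEquivLax, fun _ => rfl, fun _ _ _ => rfl⟩, rfl,
    fun M => isTypeL_cotensorFunctor M, takeuchi_isEquivalence _,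
    equivariantTakeuchi_isEquivalence _⟩
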